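/- Let $d\ge 1$, let $\Omega=\{0,1\}^{\mathbb Z^d}$ with its product (Borel) $\sigma$-field, and let $\mathbb P$ be a translation invariant probability measure on $\Omega$. A site $x\in\mathbb Z^d$ is occupied in $\omega\in\Omega$ if $\omega(x)=1$. The cluster $\mathcal C(x)$ of an occupied site $x$ is the set of all sites that are joined to $x$ by a nearest-neighbour path of occupied sites; $\mathcal C(x)=\emptyset$ if $x$ is vacant. Let $\mathcal C_{\rm le}(x)=\mathcal C(x)$ if $x$ is the minimum of $\mathcal C(x)$ in the lexicographic order, and $\mathcal C_{\rm le}(x)=\emptyset$ otherwise. Let $\mathbb P_q$ denote the Bernoulli product measure under which the sites are independently occupied with probability $q$, and let $$p_c=\sup\{q\in[0,1]:\ \mathbb P_q\text{-a.s. there is no infinite cluster}\}$$ be the critical value of Bernoulli site percolation on $\mathbb Z^d$. **Proposition.** Suppose that for some $p<p_c$ $$\mathbb P\big(\omega(0)=1\,\big|\,\omega(y),\ y\neq 0\big)<p\qquad\mathbb P\text{-almost surely}$$ (equivalently, some version of this conditional probability is less than $p$ for every configuration). Then for every real $\alpha>1$ $$\limsup_{n\to\infty}\ \sum_{x\in\mathbb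 Z^d:\ 0<|x|<n^{\alpha}}\frac{\mathbb P\big(\{n\le|\mathcal C_{\rm le}(x)|<\infty\}\cap\{n\le|\mathcal C_{\rm le}(0)|<\infty\}\big)}{\mathbb P\big(n\le|\mathcal C_{\rm le}(0)|<\infty\big)}<\infty ,$$ where $|x|$ is the maximum norm of $x$ and a quotient $0/0$ is read as $0$. -/

import Mathlib

open MeasureTheory ProbabilityTheory Filter
open scoped ENNReal

noncomputable section

namespace SitePercolation

/-- The sites of the lattice `ℤ^d`. -/
abbrev Site (d : ℕ) : Type := Fin d → ℤ

/-- Configurations in `{0,1}^(ℤ^d)`, with `true` for `1` (occupied) and `false` for `0` (vacant).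
The measurable space is the product one, which is the Borel σ-field. -/
abbrev Config (d : ℕ) : Type := Site d → Bool

/-- The shift `(θ_z ω)(y) = ω(z + y)`. -/
def shift {d : ℕ} (z : Site d) (ω : Config d) : Config d := fun y => ω (z + y)

/-- Translation invariance of a measure on configurations. -/
def TranslationInvariant {d : ℕ} (P : Measure (Config d)) : Prop :=
  ∀ z : Site d, MeasurePreserving (shift z) P P

/-- The graph of nearest-neighbour pairs of occupied sites: `x` and `y` are adjacent if both are
occupied and they are at `ℓ¹`-distance one. -/
def occupiedGraph {d : ℕ} (ω : Config d) : SimpleGraph (Site d) where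
  Adj x y := (∑ i, |x i - y i|) = 1 ∧ ω x = true ∧ ω y = true
  symm := ⟨fun x y h => ⟨by simpa only [abs_sub_comm] using h.1, h.2.2, h.2.1⟩⟩
  loopless := ⟨fun x h => by simp at h⟩

/-- The cluster `C(x)`: the sites joined to `x` by a nearest-neighbour path of occupied sites;
it is empty if `x` is vacant. -/
def cluster {d : ℕ} (x : Site d) (ω : Config d) : Set (Site d) :=
  {y | ω x = true ∧ (occupiedGraph ω).Reachable x y}

open Classical in
/-- The cluster `C_le(x)`: it is `C(x)` if `x` is the minimum of `C(x)` in the lexicographic order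
of `ℤ^d`, and it is empty otherwise. -/
def leftCluster {d : ℕ} (x : Site d) (ω : Config d) : Set (Site d) :=
  if ∀ y ∈ cluster x ω, toLex x ≤ toLex y then cluster x ω else ∅

/-- The event `{n ≤ |C_le(x)| < ∞}`. -/
def largeLeftCluster {d : ℕ} (n : ℕ) (x : Site d) : Set (Config d) :=
  {ω | (n : ℕ∞) ≤ (leftCluster x ω).encard ∧ (leftCluster x ω).encard < ⊤}

/-- The Bernoulli product measure `P_p` on configurations: the sites are independently occupied
with probability `p`. -/
def bernoulliSite (d : ℕ) (p : unitInterval) : Measure (Config d) :=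
  Measure.infinitePi fun _ : Site d => bernoulliMeasure true false p

/-- The critical value `p_c` of Bernoulli site percolation on `ℤ^d`: the supremum of the `p ∈ [0,1]`
such that `P_p`-almost surely there is no infinite cluster. -/
def criticalValue (d : ℕ) : ℝ :=
  sSup {q : ℝ | ∃ p : unitInterval, (p : ℝ) = q ∧
    ∀ᵐ ω ∂(bernoulliSite d p), ¬ ∃ x : Site d, (cluster x ω).Infinite}

/-- The σ-field generated by the coordinates `ω(y)` with `y ≠ 0`. -/
@[reducible] def offOrigin (d : ℕ) : MeasurableSpace (Config d) :=
  MeasurableSpace.comap (fun (ω : Config d) (y : {y : Site d // y ≠ 0}) => ω y.1) inferInstance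

theorem offOrigin_le (d : ℕ) : offOrigin d ≤ (inferInstance : MeasurableSpace (Config d)) := by
  have h : Measurable (fun (ω : Config d) (y : {y : Site d // y ≠ 0}) => ω y.1) := by fun_prop
  exact h.comap_le

/-- Domination in the sense of Holley by the Bernoulli measure of density `p`: the conditional
probability `P(ω(0) = 1 | ω(y), y ≠ 0)` is less than `p`. As conditional probabilities are defined up to
null sets, the inequality holds almost surely; equivalently, some version of the conditional
probability satisfies it for every configuration. -/
def HolleyDominated {d : ℕ} (P : Measure (Config d)) (p : ℝ) : Prop :=
  ∀ᵐ ω ∂P, (P⟦{η : Config d | η 0 = true}|offOrigin d⟧) ω < p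

/-- The second-moment condition: for every real `α > 1`, the limit superior as `n → ∞` of
`∑_{0 < |x| < n^α} P(n ≤ |C_le(x)| < ∞, n ≤ |C_le(0)| < ∞) / P(n ≤ |C_le(0)| < ∞)` is finite.
Here `|x|` is the maximum norm, and the quotients are taken in `[0,∞]` with `0 / 0 = 0`. -/
def SecondMomentCondition {d : ℕ} (P : Measure (Config d)) : Prop :=
  ∀ α : ℝ, 1 < α →
    limsup (fun n : ℕ =>
      ∑' x : {x : Site d // 0 < ‖x‖ ∧ ‖x‖ < (n : ℝ) ^ α},
        P (largeLeftCluster n x.1 ∩ largeLeftCluster n 0) / P (largeLeftCluster n (0 : Site d)))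
      atTop < ⊤

end SitePercolation

end

open MeasureTheory ProbabilityTheory Filter
open scoped ENNReal

noncomputable section

namespace SitePercolation

variable {d : ℕ}

/-! The sum has only polynomially many terms in `n`, so it suffices that each quotient decays like
`r ^ k` with `r < 1` and `k` of order `n ^ (1/d)`. Split the event at `0` according to the value `A`
of the cluster of `0`; the event that this cluster equals `A` depends only on `A` and its outer
boundary. If `x ≠ 0` is the minimum of another finite cluster with at least `n` sites, that cluster
avoids `A` and its boundary. Having `n` sites, it must reach a distance of order `n ^ (1/d)` from
`x`. The task is to bound this conditional probability uniformly in `A`.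

The hypothesis on `P` enters only through `Subordinate`: given finitely many other sites, a site is
occupied with probability at most `p`. Hence, conditionally on any event determined by finitely many
sites, increasing events of disjoint finite sets are no likelier than under Bernoulli percolation
(`Subordinate.measureReal_inter_le`).

Decay comes from a site version of the Duminil-Copin–Tassion argument. Let `φ_p(S)` (`boundaryMean`)
be the expected number of outer boundary sites of `S` touched by the cluster of `0` in `S`. If
`φ_p(S) < 1` for one finite `S` containing `0`, then a cluster reaching distance `k * L` must leave
successive translates of `S`; exploring these one at a time costs a factor `φ_p(S)` each
(`Subordinate.reachDist_le`).

Such an `S` exists when `p < p_c` (`exists_boundaryMean_lt_one`). Otherwise `φ_s(S) ≥ 1` for all `S`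
and all `s ≥ p`, and Russo's formula gives `(1 - s) θ'(s) ≥ 1 - θ(s)` for the probability `θ` of
leaving a box (`deriv_weight_exitsFrom_ge`). Then `θ(q) ≥ (q - p) / 2` uniformly over boxes, so
infinite clusters have positive probability at every `q > p`, against the definition of `p_c`. -/

/-! ### Finite Bernoulli weights -/

/-- The configuration whose occupied sites are those of a finite set. -/
def ofFinset (S : Finset (Site d)) : Config d := fun y => decide (y ∈ S)

/-- The probability that the configuration lies in `F` when the sites of `D` are independently
occupied with probability `p` and all other sites are vacant. -/
def weight (p : ℝ) (D : Finset (Site d)) (F : Set (Config d)) : ℝ :=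
  ∑ S ∈ D.powerset, p ^ S.card * (1 - p) ^ (D \ S).card * F.indicator 1 (ofFinset S)

theorem ofFinset_insert (a : Site d) (S : Finset (Site d)) :
    ofFinset (insert a S) = Function.update (ofFinset S) a true := by
  ext y
  by_cases h : y = a
  · subst h; simp [ofFinset]
  · simp [ofFinset, h]

theorem ofFinset_of_notMem {S : Finset (Site d)} {a : Site d} (h : a ∉ S) :
    ofFinset S a = false := by simp [ofFinset, h]

theorem weight_empty (p : ℝ) (F : Set (Config d)) :
    weight p ∅ F = F.indicator 1 (fun _ => false) := by
  have : ofFinset (∅ : Finset (Site d)) = fun _ => false := by ext y; simp [ofFinset]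
  simp [weight, this]

theorem weight_congr (p : ℝ) (D : Finset (Site d)) {F G : Set (Config d)}
    (h : ∀ ω : Config d, (∀ y ∉ D, ω y = false) → (ω ∈ F ↔ ω ∈ G)) :
    weight p D F = weight p D G := by
  refine Finset.sum_congr rfl fun S hS => ?_
  congr 1
  have := h (ofFinset S) fun y hy =>
    ofFinset_of_notMem fun h => hy (Finset.mem_powerset.1 hS h)
  by_cases hF : ofFinset S ∈ F
  · rw [Set.indicator_of_mem hF, Set.indicator_of_mem (this.1 hF)]
  · rw [Set.indicator_of_notMem hF, Set.indicator_of_notMem (mt this.2 hF)]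

theorem weight_mono_set {p : ℝ} (h0 : 0 ≤ p) (h1 : p ≤ 1) (D : Finset (Site d))
    {F G : Set (Config d)} (h : F ⊆ G) : weight p D F ≤ weight p D G := by
  have : 0 ≤ 1 - p := by linarith
  refine Finset.sum_le_sum fun S _ => mul_le_mul_of_nonneg_left ?_ (by positivity)
  exact Set.indicator_le_indicator_of_subset h (fun _ => zero_le_one) _

theorem weight_nonneg {p : ℝ} (h0 : 0 ≤ p) (h1 : p ≤ 1) (D : Finset (Site d))
    (F : Set (Config d)) : 0 ≤ weight p D F := by
  have : 0 ≤ 1 - p := by linarith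
  exact Finset.sum_nonneg fun S _ => mul_nonneg (by positivity)
    (Set.indicator_nonneg (fun _ _ => zero_le_one) _)

/-- Conditioning on the state of one site; the inductions on `D` below rest on this recursion. No
update is needed in the vacant case, because `a ∉ D` is already vacant. -/
theorem weight_insert (p : ℝ) {D : Finset (Site d)} {a : Site d} (ha : a ∉ D)
    (F : Set (Config d)) :
    weight p (insert a D) F
      = p * weight p D {ω | Function.update ω a true ∈ F} + (1 - p) * weight p D F := by
  unfold weight
  rw [Finset.sum_powerset_insert ha, add_comm, Finset.mul_sum, Finset.mul_sum]
  congr 1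
  · refine Finset.sum_congr rfl fun S hS => ?_
    have haS : a ∉ S := fun h => ha (Finset.mem_powerset.1 hS h)
    have h1 : insert a D \ insert a S = D \ S := by
      ext y; by_cases h : y = a
      · subst h; simp [ha]
      · simp [h]
    rw [Finset.card_insert_of_notMem haS, h1, ofFinset_insert, pow_succ]
    have : F.indicator (1 : Config d → ℝ) (Function.update (ofFinset S) a true)
        = Set.indicator {ω | Function.update ω a true ∈ F} 1 (ofFinset S) := by
      simp [Set.indicator]
    rw [this]; ring
  · refine Finset.sum_congr rfl fun S hS => ?_
    have haS : a ∉ S := fun h => ha (Finset.mem_powerset.1 hS h)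
    rw [Finset.insert_sdiff_of_notMem _ haS, Finset.card_insert_of_notMem (by simp [ha]), pow_succ]
    ring

theorem update_false_eq {ω : Config d} {a : Site d} (h : ω a = false) :
    Function.update ω a false = ω := by
  rw [← h]; exact Function.update_eq_self a ω

theorem le_update_true (ω : Config d) (a : Site d) : ω ≤ Function.update ω a true := by
  intro y
  by_cases h : y = a
  · subst h; simp [Bool.le_true]
  · simp [h]

theorem isUpperSet_update_true {F : Set (Config d)} (hF : IsUpperSet F) (a : Site d) :
    IsUpperSet {ω : Config d | Function.update ω a true ∈ F} := by
  intro ω ω' h hω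
  refine hF ?_ hω
  intro y
  by_cases hy : y = a
  · subst hy; simp
  · simpa [hy] using h y

theorem weight_le_update_true {p : ℝ} (h0 : 0 ≤ p) (h1 : p ≤ 1) (D : Finset (Site d))
    {F : Set (Config d)} (hF : IsUpperSet F) (a : Site d) :
    weight p D F ≤ weight p D {ω | Function.update ω a true ∈ F} :=
  weight_mono_set h0 h1 D fun ω hω => hF (le_update_true ω a) hω

theorem weight_mono_finset {p : ℝ} (h0 : 0 ≤ p) (h1 : p ≤ 1) {D D' : Finset (Site d)}
    (hD : D ⊆ D') {F : Set (Config d)} (hF : IsUpperSet F) :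
    weight p D F ≤ weight p D' F := by
  rw [← Finset.sdiff_union_of_subset hD]
  generalize D' \ D = E
  induction E using Finset.induction_on with
  | empty => simp
  | insert a E _ ih =>
    rw [Finset.insert_union]
    by_cases ha : a ∈ E ∪ D
    · rwa [Finset.insert_eq_of_mem ha]
    · rw [weight_insert p ha]
      have h4 := weight_le_update_true h0 h1 (E ∪ D) hF a
      nlinarith

theorem weight_mono_param {p q : ℝ} (h0 : 0 ≤ p) (hpq : p ≤ q) (h1 : q ≤ 1)
    (D : Finset (Site d)) {F : Set (Config d)} (hF : IsUpperSet F) :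
    weight p D F ≤ weight q D F := by
  induction D using Finset.induction_on generalizing F with
  | empty => simp [weight_empty]
  | insert a D ha ih =>
    rw [weight_insert p ha, weight_insert q ha]
    have h2 := ih hF
    have h3 := ih (isUpperSet_update_true hF a)
    have h4 := weight_le_update_true (h0.trans hpq) h1 D hF a
    nlinarith

/-- Russo's formula, for arbitrary events: by the product rule, the newly added site contributes its
own influence and the remaining terms recombine through `weight_insert`. -/
theorem weight_hasDerivAt (p : ℝ) (D : Finset (Site d)) (F : Set (Config d)) :
    HasDerivAt (fun q => weight q D F)
      (∑ z ∈ D, (weight p D {ω | Function.update ω z true ∈ F}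
        - weight p D {ω | Function.update ω z false ∈ F})) p := by
  induction D using Finset.induction_on generalizing F with
  | empty => simpa [weight_empty] using hasDerivAt_const p _
  | insert a D ha ih =>
    have hf : (fun q => weight q (insert a D) F) = fun q =>
        q * weight q D {ω | Function.update ω a true ∈ F} + (1 - q) * weight q D F := by
      ext q; exact weight_insert q ha F
    rw [hf]
    have h1 := (hasDerivAt_id p).mul (ih {ω | Function.update ω a true ∈ F})
    have h2 := ((hasDerivAt_id p).const_sub 1).mul (ih F)
    refine (h1.add h2).congr_deriv ?_
    have e0 : weight p D {ω | Function.update ω a false ∈ F} = weight p D F :=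
      weight_congr p D fun ω hω => by simp [update_false_eq (hω a ha)]
    have ez : ∀ z ∈ D, weight p (insert a D) {ω | Function.update ω z true ∈ F}
        - weight p (insert a D) {ω | Function.update ω z false ∈ F}
        = p * (weight p D {ω | Function.update (Function.update ω z true) a true ∈ F}
            - weight p D {ω | Function.update (Function.update ω z false) a true ∈ F})
          + (1 - p) * (weight p D {ω | Function.update ω z true ∈ F}
            - weight p D {ω | Function.update ω z false ∈ F}) := by
      intro z hz
      have hza : a ≠ z := fun h => ha (h ▸ hz)
      rw [weight_insert p ha, weight_insert p ha]
      simp only [Set.mem_ofPred_eq]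
      simp only [Function.update_comm hza]
      ring
    rw [Finset.sum_insert ha, Finset.sum_congr rfl ez, Finset.sum_add_distrib, ← Finset.mul_sum,
      ← Finset.mul_sum, weight_insert p ha, weight_insert p ha]
    simp only [Set.mem_ofPred_eq, Function.update_idem, e0, id]
    ring

theorem shift_update (x a : Site d) (ω : Config d) (b : Bool) :
    shift (-x) (Function.update ω a b) = Function.update (shift (-x) ω) (x + a) b := by
  ext y
  by_cases h : y = x + a
  · subst h; simp [shift]
  · have : -x + y ≠ a := fun e => h (by rw [← e]; abel)
    simp [shift, h, this]

theorem weight_translate (p : ℝ) (x : Site d) (D : Finset (Site d)) (F : Set (Config d)) :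
    weight p (D.image (x + ·)) F = weight p D {ω | shift (-x) ω ∈ F} := by
  induction D using Finset.induction_on generalizing F with
  | empty =>
    simp only [Finset.image_empty, weight_empty]
    simp [Set.indicator]
    rfl
  | insert a D ha ih =>
    have h2 : x + a ∉ D.image (x + ·) := by simpa using ha
    rw [Finset.image_insert, weight_insert p h2, weight_insert p ha, ih, ih]
    simp only [Set.mem_ofPred_eq, shift_update]

/-! ### Events determined by finitely many sites -/

/-- The event `E` only depends on the state of the sites of `B`. -/
def DeterminedBy (E : Set (Config d)) (B : Finset (Site d)) : Prop :=
  ∀ ω ω' : Config d, (∀ y ∈ B, ω y = ω' y) → ω ∈ E → ω' ∈ E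

open Classical in
/-- The configuration `ω` with all sites outside `D` made vacant. -/
def restrictTo (D : Set (Site d)) (ω : Config d) : Config d := fun y => if y ∈ D then ω y else false

theorem restrictTo_of_mem {D : Set (Site d)} {y : Site d} (h : y ∈ D) (ω : Config d) :
    restrictTo D ω y = ω y := by simp [restrictTo, h]

theorem restrictTo_of_notMem {D : Set (Site d)} {y : Site d} (h : y ∉ D) (ω : Config d) :
    restrictTo D ω y = false := by simp [restrictTo, h]

theorem restrictTo_eq_true {D : Set (Site d)} {y : Site d} {ω : Config d} :
    restrictTo D ω y = true ↔ y ∈ D ∧ ω y = true := by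
  by_cases h : y ∈ D <;> simp [restrictTo, h]

theorem DeterminedBy.mono {E : Set (Config d)} {B B' : Finset (Site d)} (h : DeterminedBy E B)
    (hB : B ⊆ B') : DeterminedBy E B' :=
  fun ω ω' hω => h ω ω' fun y hy => hω y (hB hy)

theorem DeterminedBy.inter {E F : Set (Config d)} {B : Finset (Site d)} (hE : DeterminedBy E B)
    (hF : DeterminedBy F B) : DeterminedBy (E ∩ F) B :=
  fun ω ω' hω h => ⟨hE ω ω' hω h.1, hF ω ω' hω h.2⟩

theorem DeterminedBy.compl {E : Set (Config d)} {B : Finset (Site d)} (hE : DeterminedBy E B) :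
    DeterminedBy Eᶜ B :=
  fun ω ω' hω h h' => h (hE ω' ω (fun y hy => (hω y hy).symm) h')

theorem determinedBy_univ (B : Finset (Site d)) : DeterminedBy Set.univ B :=
  fun _ _ _ _ => trivial

theorem determinedBy_occupied (z : Site d) : DeterminedBy {ω | ω z = true} {z} :=
  fun ω ω' hω h => by rw [← h]; exact (hω z (by simp)).symm

theorem restrictTo_congr {D : Finset (Site d)} {ω ω' : Config d} (h : ∀ y ∈ D, ω y = ω' y) :
    restrictTo (D : Set (Site d)) ω = restrictTo D ω' := by
  ext y
  by_cases hy : y ∈ D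
  · simp [restrictTo, hy, h y hy]
  · simp [restrictTo, hy]

theorem determinedBy_restrictTo (D : Finset (Site d)) (F : Set (Config d)) :
    DeterminedBy {ω | restrictTo D ω ∈ F} D := by
  intro ω ω' hω h
  simpa [restrictTo_congr hω] using h

theorem restrictTo_restrictTo {B : Set (Site d)} {D : Set (Site d)} (h : B ⊆ D) (ω : Config d) :
    restrictTo B (restrictTo D ω) = restrictTo B ω := by
  ext y
  by_cases hy : y ∈ B
  · simp [restrictTo, hy, h hy]
  · simp [restrictTo, hy]

open Classical in
/-- The configuration that equals `g` on `B` and is vacant elsewhere. -/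
def extendFrom (B : Finset (Site d)) (g : B → Bool) : Config d :=
  fun y => if h : y ∈ B then g ⟨y, h⟩ else false

/-- Cylinder form: the base lies in a finite discrete space, so measurability and independence
become automatic. -/
theorem DeterminedBy.eq_preimage_restrict {E : Set (Config d)} {B : Finset (Site d)}
    (h : DeterminedBy E B) :
    E = (fun (ω : Config d) (y : B) => ω y) ⁻¹' {g | extendFrom B g ∈ E} := by
  ext ω
  have hy : ∀ y ∈ B, ω y = extendFrom B (fun y : B => ω y) y := fun y hy => by
    simp [extendFrom, hy]
  exact ⟨h _ _ hy, h _ _ fun y h => (hy y h).symm⟩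

theorem DeterminedBy.measurableSet {E : Set (Config d)} {B : Finset (Site d)}
    (h : DeterminedBy E B) : MeasurableSet E := by
  rw [h.eq_preimage_restrict]
  exact (by fun_prop : Measurable fun (ω : Config d) (y : B) => ω y) (Set.toFinite _).measurableSet

/-! ### Comparison with the Bernoulli measure -/

/-- Given the states of finitely many other sites, each site is occupied with probability at most
`p`. -/
def Subordinate (ν : Measure (Config d)) (p : ℝ) : Prop :=
  ∀ (z : Site d) (B : Finset (Site d)) (E : Set (Config d)), z ∉ B → DeterminedBy E B →
    ν.real (E ∩ {ω | ω z = true}) ≤ p * ν.real E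

theorem restrictTo_insert_of_true {D : Finset (Site d)} {a : Site d} {ω : Config d}
    (h : ω a = true) : restrictTo (insert a D : Finset (Site d)) ω
      = Function.update (restrictTo (D : Set (Site d)) ω) a true := by
  ext y
  by_cases hy : y = a
  · subst hy; simp [restrictTo, h]
  · simp [restrictTo, hy]

theorem restrictTo_insert_of_false {D : Finset (Site d)} {a : Site d} {ω : Config d}
    (h : ω a = false) : restrictTo (insert a D : Finset (Site d)) ω
      = restrictTo (D : Set (Site d)) ω := by
  ext y
  by_cases hy : y = a
  · subst hy; simp [restrictTo, h]
  · simp [restrictTo, hy]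

/-- The event `F` seen through `D ∪ {a}`, split according to the state of `a`. -/
theorem measureReal_inter_restrictTo_insert (ν : Measure (Config d)) [IsFiniteMeasure ν]
    {D : Finset (Site d)} {a : Site d} (E F : Set (Config d)) :
    ν.real (E ∩ {ω | restrictTo (insert a D : Finset (Site d)) ω ∈ F})
      = ν.real (E ∩ {ω | restrictTo (D : Set (Site d)) ω ∈ {ω | Function.update ω a true ∈ F}}
          ∩ {ω | ω a = true})
        + ν.real ((E ∩ {ω | restrictTo (D : Set (Site d)) ω ∈ F}) \ {ω | ω a = true}) := by
  rw [← measureReal_inter_add_sdiff (s := E ∩ _) (t := {ω : Config d | ω a = true})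
    (determinedBy_occupied a).measurableSet]
  congr 2
  · ext ω
    simp only [Set.mem_inter_iff, Set.mem_ofPred_eq]
    refine and_congr_left fun h => ?_
    rw [restrictTo_insert_of_true h]
  · ext ω
    simp only [Set.mem_inter_iff, Set.mem_sdiff, Set.mem_ofPred_eq, Bool.not_eq_true]
    refine and_congr_left fun h => ?_
    rw [restrictTo_insert_of_false h]

theorem measureReal_inter_restrictTo_empty (ν : Measure (Config d)) (E F : Set (Config d)) (p : ℝ) :
    ν.real (E ∩ {ω | restrictTo (∅ : Finset (Site d)) ω ∈ F}) = ν.real E * weight p ∅ F := by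
  have h : ∀ ω : Config d, restrictTo ∅ ω = fun _ => false := by
    intro ω; ext y; simp [restrictTo]
  rw [weight_empty]
  by_cases hF : (fun _ => false : Config d) ∈ F
  · simp [h, hF, Set.indicator_of_mem]
  · simp [h, hF, Set.indicator_of_notMem]

/-- Stochastic domination, revealing the sites of `D` one by one. The event `E` is carried along so
that the bound can be used after an exploration of `B`. -/
theorem Subordinate.measureReal_inter_le {ν : Measure (Config d)} [IsFiniteMeasure ν] {p : ℝ}
    (h0 : 0 ≤ p) (h1 : p ≤ 1) (hν : Subordinate ν p) (D : Finset (Site d)) {B : Finset (Site d)}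
    (hBD : Disjoint B D) {E F : Set (Config d)} (hE : DeterminedBy E B) (hF : IsUpperSet F) :
    ν.real (E ∩ {ω | restrictTo D ω ∈ F}) ≤ ν.real E * weight p D F := by
  induction D using Finset.induction_on generalizing F with
  | empty => rw [measureReal_inter_restrictTo_empty ν E F p]
  | insert a D ha ih =>
    rw [Finset.disjoint_insert_right] at hBD
    rw [measureReal_inter_restrictTo_insert, weight_insert p ha]
    set F1 : Set (Config d) := {ω | Function.update ω a true ∈ F} with hF1
    have hFF : F ⊆ F1 := fun ω hω => hF (le_update_true ω a) hω
    set G0 := E ∩ {ω | restrictTo (D : Set (Site d)) ω ∈ F} with hG0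
    set G1 := E ∩ {ω | restrictTo (D : Set (Site d)) ω ∈ F1} with hG1
    have i0 := ih hBD.2 hF
    have i1 := ih hBD.2 (isUpperSet_update_true hF a)
    have hG : G0 ⊆ G1 := fun ω h => ⟨h.1, hFF h.2⟩
    have hB : a ∉ B ∪ D := by simp [hBD.1, ha]
    have dG0 : DeterminedBy G0 (B ∪ D) := (hE.mono Finset.subset_union_left).inter
      ((determinedBy_restrictTo D F).mono Finset.subset_union_right)
    have dG1 : DeterminedBy G1 (B ∪ D) := (hE.mono Finset.subset_union_left).inter
      ((determinedBy_restrictTo D F1).mono Finset.subset_union_right)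
    -- The occupation bound is applied only where the state of `a` matters. On `G0` the event holds
    -- either way, so no lower bound on occupation is required.
    have key := hν a (B ∪ D) (G1 ∩ G0ᶜ) hB (dG1.inter dG0.compl)
    have e1 : ν.real (G1 ∩ G0ᶜ) = ν.real G1 - ν.real G0 := by
      rw [← Set.sdiff_eq, measureReal_sdiff hG dG0.measurableSet]
    have e2 : ν.real (G1 ∩ {ω | ω a = true})
        = ν.real (G1 ∩ G0ᶜ ∩ {ω | ω a = true}) + ν.real (G0 ∩ {ω | ω a = true}) := by
      rw [← measureReal_inter_add_sdiff (s := G1 ∩ {ω : Config d | ω a = true}) dG0.measurableSet,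
        add_comm]
      congr 2
      · ext ω; simp only [Set.mem_inter_iff, Set.mem_sdiff, Set.mem_compl_iff]; tauto
      · ext ω; simp only [Set.mem_inter_iff]
        exact ⟨fun h => ⟨h.2, h.1.2⟩, fun h => ⟨⟨hG h.1, h.2⟩, h.1⟩⟩
    have e3 : ν.real (G0 ∩ {ω | ω a = true}) + ν.real (G0 \ {ω | ω a = true}) = ν.real G0 :=
      measureReal_inter_add_sdiff (determinedBy_occupied a).measurableSet
    have : ν.real G0 * (1 - p) + ν.real G1 * p
        ≤ ν.real E * weight p D F * (1 - p) + ν.real E * weight p D F1 * p :=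
      add_le_add (mul_le_mul_of_nonneg_right i0 (by linarith)) (mul_le_mul_of_nonneg_right i1 h0)
    rw [e1] at key
    linarith

theorem bernoulliSite_inter_occupied (p : unitInterval) {z : Site d} {B : Finset (Site d)}
    {E : Set (Config d)} (hz : z ∉ B) (hE : DeterminedBy E B) :
    (bernoulliSite d p).real (E ∩ {ω | ω z = true}) = p * (bernoulliSite d p).real E := by
  have hind : iIndepFun (fun (y : Site d) (ω : Config d) => ω y) (bernoulliSite d p) :=
    iIndepFun_infinitePi (X := fun _ b => b) (fun _ => measurable_id)
  have h2 := hind.indepFun_finset B {z} (by simpa using hz) (fun i => by fun_prop)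
  have h3 := h2.measure_inter_preimage_eq_mul {g | extendFrom B g ∈ E}
    {g | extendFrom {z} g ∈ {ω : Config d | ω z = true}} (Set.toFinite _).measurableSet
    (Set.toFinite _).measurableSet
  rw [← hE.eq_preimage_restrict, ← (determinedBy_occupied z).eq_preimage_restrict] at h3
  have h4 : (bernoulliSite d p).real {ω | ω z = true} = p := by
    have := (measurePreserving_eval_infinitePi
      (fun _ : Site d => bernoulliMeasure true false p) z).measureReal_preimage
      (s := {true}) (MeasurableSet.singleton _).nullMeasurableSet
    rw [bernoulliMeasure_real_apply_of_mem_of_notMem _ (by simp) (by simp) (by simp)] at this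
    exact this
  rw [measureReal_def, h3, ENNReal.toReal_mul, ← measureReal_def, ← measureReal_def, h4, mul_comm]

instance (p : unitInterval) : IsProbabilityMeasure (bernoulliSite d p) := by
  unfold bernoulliSite; infer_instance

/-- With exact independence the domination argument becomes an equality, and monotonicity of `F` is
not needed. -/
theorem bernoulliSite_inter_restrictTo (p : unitInterval) (D : Finset (Site d))
    {B : Finset (Site d)} (hBD : Disjoint B D) {E : Set (Config d)} (F : Set (Config d))
    (hE : DeterminedBy E B) :
    (bernoulliSite d p).real (E ∩ {ω | restrictTo D ω ∈ F})
      = (bernoulliSite d p).real E * weight p D F := by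
  induction D using Finset.induction_on generalizing F with
  | empty => rw [measureReal_inter_restrictTo_empty _ E F p]
  | insert a D ha ih =>
    rw [Finset.disjoint_insert_right] at hBD
    rw [measureReal_inter_restrictTo_insert, weight_insert p ha]
    have hB : a ∉ B ∪ D := by simp [hBD.1, ha]
    have dG : ∀ F, DeterminedBy (E ∩ {ω | restrictTo (D : Set (Site d)) ω ∈ F}) (B ∪ D) := fun F =>
      (hE.mono Finset.subset_union_left).inter
        ((determinedBy_restrictTo D F).mono Finset.subset_union_right)
    have i0 := ih hBD.2 F
    have i1 := ih hBD.2 {ω | Function.update ω a true ∈ F}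
    have k0 := bernoulliSite_inter_occupied p hB (dG F)
    have k1 := bernoulliSite_inter_occupied p hB (dG {ω | Function.update ω a true ∈ F})
    have e3 := measureReal_inter_add_sdiff (μ := bernoulliSite d p)
      (s := E ∩ {ω | restrictTo (D : Set (Site d)) ω ∈ F}) (determinedBy_occupied a).measurableSet
    rw [k1, i1, ← sub_eq_iff_eq_add'.2 e3.symm, k0, i0]
    ring

theorem bernoulliSite_restrictTo (p : unitInterval) (D : Finset (Site d)) (F : Set (Config d)) :
    (bernoulliSite d p).real {ω | restrictTo D ω ∈ F} = weight p D F := by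
  have := bernoulliSite_inter_restrictTo p D (Finset.disjoint_empty_left D) F
    (determinedBy_univ ∅)
  simpa using this

theorem bernoulliSite_sdiff_occupied (p : unitInterval) {z : Site d} {B : Finset (Site d)}
    {E : Set (Config d)} (hz : z ∉ B) (hE : DeterminedBy E B) :
    (bernoulliSite d p).real (E \ {ω | ω z = true}) = (1 - p) * (bernoulliSite d p).real E := by
  have e3 := measureReal_inter_add_sdiff (μ := bernoulliSite d p) (s := E)
    (determinedBy_occupied z).measurableSet
  have := bernoulliSite_inter_occupied p hz hE
  linarith

/-! ### Domination of a translation invariant measure -/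

theorem subordinate_of_holleyDominated {P : Measure (Config d)} [IsProbabilityMeasure P]
    (hP : TranslationInvariant P) {p : ℝ} (hdom : HolleyDominated P p) : Subordinate P p := by
  have h_orig : ∀ (B : Finset (Site d)) (E : Set (Config d)), 0 ∉ B → DeterminedBy E B →
      P.real (E ∩ {ω | ω 0 = true}) ≤ p * P.real E := by
    intro B E h0 hE
    have hm : MeasurableSet {η : Config d | η 0 = true} := (determinedBy_occupied 0).measurableSet
    -- Since `0 ∉ B`, the event is visible away from the origin, so the conditional probability may
    -- be integrated over it.
    have hEm : MeasurableSet[offOrigin d] E := by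
      refine ⟨(fun (g : {y : Site d // y ≠ 0} → Bool) (y : B) =>
        g ⟨y, fun h => h0 (h ▸ y.2)⟩) ⁻¹' {g | extendFrom B g ∈ E}, ?_, ?_⟩
      · exact (by fun_prop : Measurable fun (g : {y : Site d // y ≠ 0} → Bool) (y : B) =>
          g ⟨y, fun h => h0 (h ▸ y.2)⟩) (Set.toFinite _).measurableSet
      · exact hE.eq_preimage_restrict.symm
    have h1 : ∫ ω in E, (P⟦{η : Config d | η 0 = true}|offOrigin d⟧) ω ∂P
        = ∫ ω in E, ({η : Config d | η 0 = true}.indicator (fun _ => (1 : ℝ))) ω ∂P :=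
      setIntegral_condExp (offOrigin_le d) ((integrable_const 1).indicator hm) hEm
    have h2 : ∫ ω in E, ({η : Config d | η 0 = true}.indicator (fun _ => (1 : ℝ))) ω ∂P
        = P.real (E ∩ {ω | ω 0 = true}) := by
      rw [setIntegral_indicator hm]; simp
    have h3 : ∫ ω in E, (P⟦{η : Config d | η 0 = true}|offOrigin d⟧) ω ∂P
        ≤ ∫ ω in E, p ∂P := by
      refine setIntegral_mono_ae integrable_condExp.integrableOn (integrable_const p).integrableOn ?_
      filter_upwards [hdom] with ω hω using hω.le
    rw [← h2, ← h1]
    refine h3.trans (le_of_eq ?_)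
    simp [mul_comm]
  intro z B E hz hE
  have hpre : ∀ A : Set (Config d), MeasurableSet A → P.real (shift z ⁻¹' A) = P.real A :=
    fun A hA => by rw [measureReal_def, (hP z).measure_preimage hA.nullMeasurableSet, measureReal_def]
  have hsh : ∀ ω : Config d, shift (-z) (shift z ω) = ω := fun ω => by
    ext y; simp [shift]
  have hE' : DeterminedBy (shift (-z) ⁻¹' E) (B.image (-z + ·)) := by
    intro ω ω' h hω
    refine hE _ _ (fun y hy => ?_) hω
    exact h _ (Finset.mem_image_of_mem _ hy)
  have e1 : E = shift z ⁻¹' (shift (-z) ⁻¹' E) := by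
    ext ω; simp [hsh]
  have e2 : E ∩ {ω | ω z = true} = shift z ⁻¹' (shift (-z) ⁻¹' E ∩ {ω | ω 0 = true}) := by
    ext ω; simp [hsh, shift]
  have := h_orig _ _ (by simpa [neg_add_eq_zero] using hz) hE'
  have e3 : P.real (shift (-z) ⁻¹' E) = P.real E := by
    rw [← hpre _ hE'.measurableSet, ← e1]
  rwa [e2, hpre _ (hE'.measurableSet.inter (determinedBy_occupied 0).measurableSet), ← e3]

/-! ### Neighbours and clusters -/

/-- Two sites are nearest neighbours. -/
def Nbr (x y : Site d) : Prop := (∑ i, |x i - y i|) = 1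

theorem Nbr.symm {x y : Site d} (h : Nbr x y) : Nbr y x := by
  unfold Nbr at *; simpa only [abs_sub_comm] using h

theorem Nbr.norm_sub_le {x y : Site d} (h : Nbr x y) : ‖x - y‖ ≤ 1 := by
  rw [pi_norm_le_iff_of_nonneg zero_le_one]
  intro i
  have h1 : |x i - y i| ≤ 1 := by
    unfold Nbr at h
    rw [← h]
    exact Finset.single_le_sum (f := fun i => |x i - y i|) (fun _ _ => abs_nonneg _)
      (Finset.mem_univ i)
  rw [Pi.sub_apply, Int.norm_eq_abs]
  exact_mod_cast h1

theorem nbr_add_iff (x y z : Site d) : Nbr (x + y) (x + z) ↔ Nbr y z := by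
  simp [Nbr]

theorem mem_cluster_self {x : Site d} {ω : Config d} (h : ω x = true) : x ∈ cluster x ω :=
  ⟨h, .refl _⟩

theorem cluster_step {x y z : Site d} {ω : Config d} (hy : y ∈ cluster x ω) (hyω : ω y = true)
    (hyz : Nbr y z) (hz : ω z = true) : z ∈ cluster x ω :=
  ⟨hy.1, hy.2.trans (SimpleGraph.Adj.reachable ⟨hyz, hyω, hz⟩)⟩

/-- A set containing `x` and closed under steps to occupied neighbours contains the cluster. -/
theorem cluster_subset {x : Site d} {ω : Config d} {A : Set (Site d)} (hx : ω x = true → x ∈ A)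
    (h : ∀ y ∈ A, ∀ z, ω y = true → Nbr y z → ω z = true → z ∈ A) : cluster x ω ⊆ A := by
  rintro y ⟨hxω, ⟨w⟩⟩
  replace hx := hx hxω
  clear hxω
  induction w with
  | nil => exact hx
  | cons hadj _ ih => exact ih (h _ hx _ hadj.2.1 hadj.1 hadj.2.2)

theorem occupied_of_mem_cluster {x y : Site d} {ω : Config d} (h : y ∈ cluster x ω) :
    ω y = true :=
  cluster_subset (A := {y | ω y = true}) id (fun _ _ _ _ _ h => h) h

theorem cluster_succ {x y z : Site d} {ω : Config d} (hy : y ∈ cluster x ω)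
    (hyz : Nbr y z) (hz : ω z = true) : z ∈ cluster x ω :=
  cluster_step hy (occupied_of_mem_cluster hy) hyz hz

theorem mem_cluster_symm {x y : Site d} {ω : Config d} (h : y ∈ cluster x ω) :
    x ∈ cluster y ω :=
  ⟨occupied_of_mem_cluster h, h.2.symm⟩

theorem mem_cluster_trans {x y z : Site d} {ω : Config d} (h : y ∈ cluster x ω)
    (h' : z ∈ cluster y ω) : z ∈ cluster x ω :=
  ⟨h.1, h.2.trans h'.2⟩

theorem cluster_mono {x : Site d} {ω ω' : Config d} (h : ω ≤ ω') :
    cluster x ω ⊆ cluster x ω' := by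
  have h' : ∀ y, ω y = true → ω' y = true := fun y hy => by
    have := h y; rw [hy] at this; exact le_antisymm (Bool.le_true _) this
  intro y hy
  have hx := mem_cluster_self (h' x hy.1)
  exact cluster_subset (fun _ => hx) (fun y hy z _ hyz hz => cluster_succ hy hyz (h' z hz)) hy

/-- Exploring the cluster from `x` queries only its sites and their neighbours, so configurations
agreeing there yield the same cluster. -/
theorem cluster_eq_of_agree {x : Site d} {ω ω' : Config d} {A : Set (Site d)} (hx : x ∈ A)
    (h : ∀ y ∈ A, ω y = ω' y) (h' : ∀ y ∈ A, ∀ z, Nbr y z → ω z = ω' z)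
    (hA : cluster x ω = A) : cluster x ω' = A := by
  have hω : ω x = true := occupied_of_mem_cluster (hA ▸ hx : x ∈ cluster x ω)
  have hx' : x ∈ cluster x ω' := mem_cluster_self (h x hx ▸ hω)
  have h1 : cluster x ω' ⊆ A := by
    refine cluster_subset (fun _ => hx) fun y hy z _ hyz hz => ?_
    rw [← hA] at hy ⊢
    exact cluster_succ hy hyz (by rw [h' y (hA ▸ hy) z hyz]; exact hz)
  refine h1.antisymm ?_
  nth_rewrite 1 [← hA]
  refine cluster_subset (fun _ => hx') fun y hy z _ hyz hz => ?_
  exact cluster_succ hy hyz (by rw [← h' y (h1 hy) z hyz]; exact hz)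

theorem restrictTo_le (D : Set (Site d)) (ω : Config d) : restrictTo D ω ≤ ω := by
  intro y
  by_cases h : y ∈ D
  · rw [restrictTo_of_mem h]
  · rw [restrictTo_of_notMem h]; exact Bool.false_le _

theorem restrictTo_mono {D D' : Set (Site d)} (h : D ⊆ D') (ω : Config d) :
    restrictTo D ω ≤ restrictTo D' ω := by
  rw [← restrictTo_restrictTo h]; exact restrictTo_le _ _

theorem cluster_restrictTo_subset (D : Set (Site d)) (x : Site d) (ω : Config d) :
    cluster x (restrictTo D ω) ⊆ D :=
  fun _ h => (restrictTo_eq_true.1 (occupied_of_mem_cluster h)).1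

theorem cluster_shift (x z : Site d) (ω : Config d) {y : Site d} (h : y ∈ cluster x (shift z ω)) :
    z + y ∈ cluster (z + x) ω := by
  have hx : z + x ∈ cluster (z + x) ω := mem_cluster_self h.1
  exact cluster_subset (A := {y | z + y ∈ cluster (z + x) ω}) (fun _ => hx)
    (fun y hy w _ hyw hw => cluster_succ hy ((nbr_add_iff _ _ _).2 hyw) hw) h

/-! ### Outer boundaries and the functional `φ_p(S)` -/

/-- The sites outside `S` with a neighbour in `S`, as a set. -/
def outerBoundary (S : Set (Site d)) : Set (Site d) := {y | y ∉ S ∧ ∃ x ∈ S, Nbr x y}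

theorem finite_nbr (x : Site d) : {y | Nbr x y}.Finite := by
  refine (Set.toFinite (Set.Icc (x - 1) (x + 1))).subset fun y hy => ?_
  have h : ∀ i, |x i - y i| ≤ 1 := fun i => by
    have hy : (∑ i, |x i - y i|) = 1 := hy
    rw [← hy]
    exact Finset.single_le_sum (f := fun i => |x i - y i|) (fun _ _ => abs_nonneg _)
      (Finset.mem_univ i)
  refine ⟨fun i => ?_, fun i => ?_⟩ <;> have := abs_le.1 (h i) <;> simp <;> omega

theorem outerBoundary_finite (S : Finset (Site d)) : (outerBoundary (S : Set (Site d))).Finite := by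
  refine (S.finite_toSet.biUnion fun x _ => finite_nbr x).subset ?_
  rintro y ⟨_, x, hx, hxy⟩
  exact Set.mem_biUnion hx hxy

/-- The outer boundary of a finite set. -/
def bdry (S : Finset (Site d)) : Finset (Site d) := (outerBoundary_finite S).toFinset

theorem mem_bdry {S : Finset (Site d)} {y : Site d} :
    y ∈ bdry S ↔ y ∉ S ∧ ∃ x ∈ S, Nbr x y := by
  simp [bdry, outerBoundary]

/-- The event that the cluster of `x` has a neighbour of `y` among its sites. -/
def reachNbr (x y : Site d) : Set (Config d) := {ω | ∃ v ∈ cluster x ω, Nbr v y}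

theorem isUpperSet_reachNbr (x y : Site d) : IsUpperSet (reachNbr x y) :=
  fun _ _ h ⟨v, hv, hvy⟩ => ⟨v, cluster_mono h hv, hvy⟩

/-- The expected number of sites of the outer boundary of `S` that are adjacent to the cluster
of `0` in `S`. -/
def boundaryMean (p : ℝ) (S : Finset (Site d)) : ℝ := ∑ y ∈ bdry S, weight p S (reachNbr 0 y)

theorem boundaryMean_nonneg {p : ℝ} (h0 : 0 ≤ p) (h1 : p ≤ 1) (S : Finset (Site d)) :
    0 ≤ boundaryMean p S :=
  Finset.sum_nonneg fun _ _ => weight_nonneg h0 h1 _ _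

theorem boundaryMean_mono {p q : ℝ} (h0 : 0 ≤ p) (hpq : p ≤ q) (h1 : q ≤ 1)
    (S : Finset (Site d)) : boundaryMean p S ≤ boundaryMean q S :=
  Finset.sum_le_sum fun _ _ => weight_mono_param h0 hpq h1 _ (isUpperSet_reachNbr _ _)

theorem bdry_translate (x : Site d) (S : Finset (Site d)) :
    bdry (S.image (x + ·)) = (bdry S).image (x + ·) := by
  ext y
  obtain ⟨y, rfl⟩ : ∃ y', y = x + y' := ⟨-x + y, by abel⟩
  have h : ∀ {T : Finset (Site d)} {z : Site d}, x + z ∈ T.image (x + ·) ↔ z ∈ T := by simp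
  rw [h, mem_bdry, mem_bdry, h]
  refine and_congr_right fun _ => ⟨?_, ?_⟩
  · rintro ⟨w, hw, hwy⟩
    obtain ⟨w, rfl⟩ : ∃ w', w = x + w' := ⟨-x + w, by abel⟩
    exact ⟨w, h.1 hw, (nbr_add_iff _ _ _).1 hwy⟩
  · rintro ⟨w, hw, hwy⟩
    exact ⟨x + w, h.2 hw, (nbr_add_iff _ _ _).2 hwy⟩

theorem weight_reachNbr_translate {p : ℝ} (h0 : 0 ≤ p) (h1 : p ≤ 1) (x y : Site d)
    (S : Finset (Site d)) :
    weight p (S.image (x + ·)) (reachNbr x (x + y)) ≤ weight p S (reachNbr 0 y) := by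
  rw [weight_translate]
  refine weight_mono_set h0 h1 _ ?_
  rintro ω ⟨v, hv, hvy⟩
  refine ⟨-x + v, ?_, ?_⟩
  · simpa using cluster_shift x (-x) ω hv
  · rw [← nbr_add_iff x]; simpa using hvy

theorem sum_bdry_translate_le {p : ℝ} (h0 : 0 ≤ p) (h1 : p ≤ 1) (x : Site d)
    (S : Finset (Site d)) :
    ∑ y ∈ bdry (S.image (x + ·)), weight p (S.image (x + ·)) (reachNbr x y)
      ≤ boundaryMean p S := by
  rw [bdry_translate, Finset.sum_image (fun _ _ _ _ h => add_left_cancel h)]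
  exact Finset.sum_le_sum fun y _ => weight_reachNbr_translate h0 h1 x y S

/-! ### Decay of the radius -/

/-- The event that the cluster of `x` in the complement of `B` reaches distance `r` from `x`. -/
def reachDist (r : ℝ) (B : Finset (Site d)) (x : Site d) : Set (Config d) :=
  {ω | ∃ y ∈ cluster x (restrictTo (B : Set (Site d))ᶜ ω), r ≤ ‖y - x‖}

theorem determinedBy_cluster_eq (x : Site d) (D A : Finset (Site d)) (hx : x ∈ A) :
    DeterminedBy {ω | cluster x (restrictTo (D : Set (Site d)) ω) = A} (A ∪ bdry A ∩ D) := by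
  intro ω ω' h hA
  refine cluster_eq_of_agree hx (fun y hy => ?_) (fun y hy z hyz => ?_) hA
  · by_cases hD : y ∈ (D : Set (Site d))
    · rw [restrictTo_of_mem hD, restrictTo_of_mem hD, h y (Finset.mem_union_left _ hy)]
    · rw [restrictTo_of_notMem hD, restrictTo_of_notMem hD]
  · by_cases hD : z ∈ (D : Set (Site d))
    · rw [restrictTo_of_mem hD, restrictTo_of_mem hD, h z ?_]
      by_cases hz : z ∈ A
      · exact Finset.mem_union_left _ hz
      · exact Finset.mem_union_right _
          (Finset.mem_inter.2 ⟨mem_bdry.2 ⟨hz, y, hy, hyz⟩, hD⟩)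
    · rw [restrictTo_of_notMem hD, restrictTo_of_notMem hD]

/-- A cluster that leaves `D'` after the exploration of the cluster `A` of `x` in `D' \ B` contains
a connection to far away from some boundary site of `D'` adjacent to `A` that avoids the explored
sites. -/
theorem exists_exit {x y₀ : Site d} {D' B A : Finset (Site d)} {ω : Config d} (hx : x ∈ D')
    (hA : cluster x (restrictTo ((D' \ B : Finset (Site d)) : Set (Site d)) ω) = A)
    (hy₀ : y₀ ∈ cluster x (restrictTo (B : Set (Site d))ᶜ ω)) (hy₀' : y₀ ∉ D') :
    ∃ y ∈ bdry D', (∃ v ∈ A, Nbr v y) ∧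
      y₀ ∈ cluster y (restrictTo ((B ∪ (A ∪ bdry A ∩ D') : Finset (Site d)) : Set (Site d))ᶜ ω) := by
  classical
  set B' := B ∪ (A ∪ bdry A ∩ D') with hB'
  have hAD : ∀ v ∈ A, v ∈ D' ∧ v ∉ B := fun v hv => by
    have := cluster_restrictTo_subset _ _ _ (hA ▸ (Finset.mem_coe.2 hv) :
      v ∈ cluster x (restrictTo ((D' \ B : Finset (Site d)) : Set (Site d)) ω))
    simpa using this
  have hxA : x ∈ A := by
    have h1 := restrictTo_eq_true.1 hy₀.1
    rw [← Finset.mem_coe, ← hA]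
    exact mem_cluster_self (restrictTo_eq_true.2 ⟨by simpa [hx] using h1.1, h1.2⟩)
  by_contra! hcon
  set K := cluster y₀ (restrictTo (B' : Set (Site d))ᶜ ω) with hK
  have hcon' : ∀ y ∈ K, y ∉ D' → ∀ v ∈ A, ¬ Nbr v y := by
    intro y hy hyD v hv hvy
    exact hcon y (mem_bdry.2 ⟨hyD, v, (hAD v hv).1, hvy⟩) ⟨v, hv, hvy⟩ (mem_cluster_symm hy)
  have hy₀ω := restrictTo_eq_true.1 (occupied_of_mem_cluster hy₀)
  -- With no exit site, the cluster of `y₀` off `B` could never enter the explored region, yet it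
  -- contains `x ∈ A`. An occupied site of `B'` outside `B` must lie in `A`, since the explored
  -- boundary inside `D'` is vacant off `B`. Its predecessor `v` would then be explored itself or be
  -- an exit site.
  have hsub : cluster y₀ (restrictTo (B : Set (Site d))ᶜ ω) ⊆ K := by
    refine cluster_subset (fun _ => mem_cluster_self (restrictTo_eq_true.2 ⟨?_, hy₀ω.2⟩)) ?_
    · have h1 : y₀ ∉ A := fun h => hy₀' (hAD _ h).1
      have h2 : y₀ ∉ B := by simpa using hy₀ω.1
      simp [hB', h1, h2, hy₀']
    · intro v hv w _ hvw hw
      have hw' := restrictTo_eq_true.1 hw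
      by_cases hwB : w ∈ B'
      · exfalso
        have hv' := restrictTo_eq_true.1 (occupied_of_mem_cluster hv)
        have hvB : v ∉ B' := by simpa using hv'.1
        have hwB2 : w ∉ B := by simpa using hw'.1
        have hwA : w ∈ A := by
          simp only [hB', Finset.mem_union, Finset.mem_inter, hwB2, false_or] at hwB
          rcases hwB with h | ⟨h, hD⟩
          · exact h
          · obtain ⟨_, u, hu, huw⟩ := mem_bdry.1 h
            rw [← Finset.mem_coe, ← hA] at hu ⊢
            exact cluster_succ hu huw (restrictTo_eq_true.2 ⟨by simp [hD, hwB2], hw'.2⟩)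
        by_cases hvD : v ∈ D'
        · refine hvB ?_
          by_cases hvA : v ∈ A
          · simp [hB', hvA]
          · have : v ∈ bdry A := mem_bdry.2 ⟨hvA, w, hwA, hvw.symm⟩
            simp [hB', this, hvD]
        · exact hcon' v hv hvD w hwA hvw.symm
      · exact cluster_succ hv hvw (restrictTo_eq_true.2 ⟨by simpa using hwB, hw'.2⟩)
  have hxK : x ∈ K := hsub (mem_cluster_symm hy₀)
  have := (restrictTo_eq_true.1 (occupied_of_mem_cluster hxK)).1
  simp [hB', hxA] at this

theorem Subordinate.reachDist_le {ν : Measure (Config d)} [IsFiniteMeasure ν] {p : ℝ}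
    (h0 : 0 ≤ p) (h1 : p ≤ 1) (hν : Subordinate ν p) {S : Finset (Site d)} (hS : 0 ∈ S)
    {L : ℕ} (hL : ∀ s ∈ S, ‖s‖ + 1 ≤ L) (k : ℕ) (B : Finset (Site d)) (E : Set (Config d))
    (hE : DeterminedBy E B) (x : Site d) :
    ν.real (E ∩ reachDist (k * L) B x) ≤ boundaryMean p S ^ k * ν.real E := by
  classical
  induction k generalizing B E x with
  | zero => simpa using measureReal_mono (μ := ν) Set.inter_subset_left
  | succ k ih =>
    set D' := S.image (x + ·) with hD'
    have hxD' : x ∈ D' := Finset.mem_image.2 ⟨0, hS, by simp⟩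
    have hD'L : ∀ s ∈ D', ‖s - x‖ + 1 ≤ L := by
      intro s hs
      obtain ⟨t, ht, rfl⟩ := Finset.mem_image.1 hs
      simpa using hL t ht
    set D := D' \ B with hD
    -- Explore the cluster of `x` in the translate of `S` with `B` removed. Its value `A` is added
    -- to the conditioning, which is why the induction ranges over all `B` and `E`.
    set C : Finset (Site d) → Set (Config d) := fun A =>
      {ω | cluster x (restrictTo (D : Set (Site d)) ω) = A} with hC
    set I : Finset (Finset (Site d) × Site d) :=
      (D.powerset ×ˢ bdry D').filter fun a => x ∈ a.1 ∧ ∃ v ∈ a.1, Nbr v a.2 with hI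
    have hdet : ∀ A ⊆ D, x ∈ A → DeterminedBy (E ∩ C A) (B ∪ (A ∪ bdry A ∩ D')) := by
      intro A hA hx
      refine (hE.mono Finset.subset_union_left).inter
        ((determinedBy_cluster_eq x D A hx).mono ?_)
      refine Finset.Subset.trans ?_ Finset.subset_union_right
      exact Finset.union_subset_union_right
        (Finset.inter_subset_inter_left Finset.sdiff_subset)
    have hcov : E ∩ reachDist ((k + 1 : ℕ) * L) B x ⊆
        ⋃ a ∈ I, (E ∩ C a.1) ∩ reachDist (k * L) (B ∪ (a.1 ∪ bdry a.1 ∩ D')) a.2 := by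
      rintro ω ⟨hωE, y₀, hy₀, hr⟩
      have hy₀' : y₀ ∉ D' := fun h => by
        have h2 := hD'L _ h
        have : (L : ℝ) ≤ (k + 1 : ℕ) * L := by
          push_cast; nlinarith [(Nat.cast_nonneg k : (0 : ℝ) ≤ k), (Nat.cast_nonneg L : (0 : ℝ) ≤ L)]
        linarith
      have hfin : (cluster x (restrictTo (D : Set (Site d)) ω)).Finite :=
        D.finite_toSet.subset (cluster_restrictTo_subset _ _ _)
      have hA : cluster x (restrictTo (D : Set (Site d)) ω) = hfin.toFinset := by simp
      obtain ⟨y, hy, ⟨v, hv, hvy⟩, hyy⟩ := exists_exit hxD' hA hy₀ hy₀'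
      have hsub : hfin.toFinset ⊆ D := by
        simpa using cluster_restrictTo_subset _ _ _
      have hxA : x ∈ hfin.toFinset := by
        rw [Set.Finite.mem_toFinset] at hv ⊢
        exact mem_cluster_self hv.1
      refine Set.mem_biUnion (x := (hfin.toFinset, y)) ?_ ⟨⟨hωE, hA⟩, y₀, hyy, ?_⟩
      · simp only [hI, Finset.mem_coe, Finset.mem_filter, Finset.mem_product, Finset.mem_powerset]
        exact ⟨⟨hsub, hy⟩, hxA, v, hv, hvy⟩
      · obtain ⟨_, w, hw, hwy⟩ := mem_bdry.1 hy
        -- The `+ 1` in `hL` covers the step from `D'` to its outer boundary, so distance `k * L`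
        -- still remains from `y`.
        have t1 : ‖y - x‖ ≤ L := by
          have h3 := hwy.symm.norm_sub_le
          have h4 : ‖y - x‖ ≤ ‖y - w‖ + ‖w - x‖ := norm_sub_le_norm_sub_add_norm_sub _ _ _
          linarith [hD'L w hw]
        have t2 : ‖y₀ - x‖ ≤ ‖y₀ - y‖ + ‖y - x‖ := norm_sub_le_norm_sub_add_norm_sub _ _ _
        push_cast at hr
        simp only
        linarith
    have hφ := boundaryMean_nonneg h0 h1 S
    calc ν.real (E ∩ reachDist ((k + 1 : ℕ) * L) B x)
        ≤ ∑ a ∈ I, ν.real ((E ∩ C a.1) ∩ reachDist (k * L) (B ∪ (a.1 ∪ bdry a.1 ∩ D')) a.2) :=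
          (measureReal_mono hcov (measure_ne_top _ _)).trans (measureReal_biUnion_finset_le _ _)
      _ ≤ ∑ a ∈ I, boundaryMean p S ^ k * ν.real (E ∩ C a.1) := by
          refine Finset.sum_le_sum fun a ha => ?_
          simp only [hI, Finset.mem_filter, Finset.mem_product, Finset.mem_powerset] at ha
          exact ih _ _ (hdet a.1 ha.1.1 ha.2.1) _
      _ = boundaryMean p S ^ k * ∑ y ∈ bdry D', ∑ A ∈ D.powerset with x ∈ A ∧ ∃ v ∈ A, Nbr v y,
            ν.real (E ∩ C A) := by
          rw [← Finset.mul_sum, hI, Finset.sum_filter, Finset.sum_product_right]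
          simp_rw [Finset.sum_filter]
      _ ≤ boundaryMean p S ^ k * ∑ y ∈ bdry D', ν.real E * weight p D' (reachNbr x y) := by
          refine mul_le_mul_of_nonneg_left (Finset.sum_le_sum fun y _ => ?_) (by positivity)
          -- For fixed `y` the values of `A` are disjoint, so their sum is one increasing event in
          -- `D`, to which domination applies.
          calc _ = ν.real (⋃ A ∈ D.powerset.filter (fun A => x ∈ A ∧ ∃ v ∈ A, Nbr v y),
                E ∩ C A) := by
                rw [measureReal_biUnion_finset]
                · intro A _ A' _ hne
                  refine Set.disjoint_left.2 fun ω h h' => hne ?_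
                  exact Finset.coe_injective (h.2.symm.trans h'.2)
                · intro A hA
                  simp only [Finset.mem_filter, Finset.mem_powerset] at hA
                  exact (hdet A hA.1 hA.2.1).measurableSet
            _ ≤ ν.real (E ∩ {ω | restrictTo (D : Set (Site d)) ω ∈ reachNbr x y}) := by
                refine measureReal_mono (Set.iUnion₂_subset fun A hA => ?_)
                simp only [Finset.mem_filter, Finset.mem_powerset] at hA
                obtain ⟨_, _, v, hv, hvy⟩ := hA
                rintro ω ⟨hωE, hω⟩
                refine ⟨hωE, v, ?_, hvy⟩
                have hω : cluster x (restrictTo (D : Set (Site d)) ω) = A := hω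
                rw [hω]; exact hv
            _ ≤ ν.real E * weight p D (reachNbr x y) :=
                hν.measureReal_inter_le h0 h1 D Finset.disjoint_sdiff hE
                  (isUpperSet_reachNbr _ _)
            _ ≤ ν.real E * weight p D' (reachNbr x y) :=
                mul_le_mul_of_nonneg_left (weight_mono_finset h0 h1 Finset.sdiff_subset
                  (isUpperSet_reachNbr _ _)) measureReal_nonneg
      _ ≤ boundaryMean p S ^ k * (ν.real E * boundaryMean p S) := by
          rw [← Finset.mul_sum]
          exact mul_le_mul_of_nonneg_left (mul_le_mul_of_nonneg_left
            (sum_bdry_translate_le h0 h1 x S) measureReal_nonneg) (by positivity)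
      _ = boundaryMean p S ^ (k + 1) * ν.real E := by ring

/-! ### The differential inequality -/

/-- The event that the cluster of `x` has a neighbour outside `D`. -/
def exitsFrom (D : Finset (Site d)) (x : Site d) : Set (Config d) :=
  {ω | ∃ v ∈ cluster x ω, ∃ z ∉ D, Nbr v z}

theorem isUpperSet_exitsFrom (D : Finset (Site d)) (x : Site d) : IsUpperSet (exitsFrom D x) :=
  fun _ _ h ⟨v, hv, hz⟩ => ⟨v, cluster_mono h hv, hz⟩

/-- The sites whose cluster in `D` has a neighbour outside `D`. -/
def exiting (D : Finset (Site d)) (ω : Config d) : Set (Site d) :=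
  {v | restrictTo D ω ∈ exitsFrom D v}

/-- The sites of `D` that are not in `exiting D ω` and have no neighbour there or outside `D`. -/
def hidden (D : Finset (Site d)) (ω : Config d) : Set (Site d) :=
  {v | v ∈ D ∧ v ∉ exiting D ω ∧ ∀ w, Nbr v w → w ∉ exiting D ω ∧ w ∈ D}

theorem mem_exitsFrom_of_nbr {D : Finset (Site d)} {ω ω' : Config d} {z w : Site d}
    (hle : restrictTo D ω ≤ ω') (hz : ω' z = true) (hzw : Nbr z w)
    (hw : w ∈ exiting D ω ∨ w ∉ D) : ω' ∈ exitsFrom D z := by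
  rcases hw with ⟨u, hu, hu'⟩ | hw
  · have h1 := cluster_mono hle hu
    exact ⟨u, mem_cluster_trans (cluster_succ (mem_cluster_self hz) hzw h1.1) h1, hu'⟩
  · exact ⟨z, mem_cluster_self hz, w, hw, hzw⟩

theorem mem_exitsFrom_of_mem_cluster {D : Finset (Site d)} {ω : Config d} {x y : Site d}
    (h : y ∈ cluster x ω) (hy : ω ∈ exitsFrom D y) : ω ∈ exitsFrom D x := by
  obtain ⟨u, hu, hu'⟩ := hy
  exact ⟨u, mem_cluster_trans h hu, hu'⟩

/-- Sites of `U` touch neither an exiting site nor the complement of `D`. Exploring the exiting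
clusters inwards from the complement therefore never queries `U`. -/
theorem exiting_eq_of_agree {D U : Finset (Site d)} {ω ω' : Config d}
    (h : ∀ y ∈ D \ U, ω y = ω' y) (hU : hidden D ω = U) : exiting D ω' = exiting D ω := by
  have hU' : ∀ v, v ∈ U → v ∉ exiting D ω ∧ ∀ w, Nbr v w → w ∉ exiting D ω ∧ w ∈ D := by
    intro v hv
    rw [← Finset.mem_coe, ← hU] at hv
    exact hv.2
  have hag : ∀ y ∉ U, restrictTo (D : Set (Site d)) ω y = restrictTo D ω' y := by
    intro y hy
    by_cases hD : y ∈ (D : Set (Site d))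
    · rw [restrictTo_of_mem hD, restrictTo_of_mem hD, h y (Finset.mem_sdiff.2 ⟨hD, hy⟩)]
    · rw [restrictTo_of_notMem hD, restrictTo_of_notMem hD]
  have hexU : ∀ v ∈ exiting D ω, v ∉ U := fun v hv hvU => (hU' v hvU).1 hv
  have hcl : ∀ v ∈ exiting D ω, ∀ w ∈ cluster v (restrictTo (D : Set (Site d)) ω),
      w ∈ exiting D ω := fun v hv w hw => mem_exitsFrom_of_mem_cluster (mem_cluster_symm hw) hv
  refine Set.Subset.antisymm ?_ ?_
  · rintro v ⟨w, hw, z, hz, hwz⟩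
    have hwU : w ∉ U := fun hwU => hz ((hU' w hwU).2 z hwz).2
    have hwω : restrictTo (D : Set (Site d)) ω w = true := by
      rw [hag w hwU]; exact occupied_of_mem_cluster hw
    have hwe : w ∈ exiting D ω := ⟨w, mem_cluster_self hwω, z, hz, hwz⟩
    refine cluster_subset (A := exiting D ω) (fun _ => hwe) (fun a ha b _ hab hb => ?_)
      (mem_cluster_symm hw)
    have hbU : b ∉ U := fun hbU => ((hU' b hbU).2 a hab.symm).1 ha
    rw [← hag b hbU] at hb
    exact mem_exitsFrom_of_nbr le_rfl hb hab.symm (Or.inl ha)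
  · intro v hv
    obtain ⟨w, hw, hwz⟩ := id hv
    refine ⟨w, ?_, hwz⟩
    have hvω' : restrictTo (D : Set (Site d)) ω' v = true := by
      rw [← hag v (hexU v hv)]; exact hw.1
    refine (cluster_subset (A := {y | y ∈ exiting D ω ∧ y ∈ cluster v (restrictTo D ω')})
      (fun _ => ⟨hv, mem_cluster_self hvω'⟩) (fun a ha b haω hab hb => ?_) hw).2
    have hbe : b ∈ exiting D ω := hcl a ha.1 b (cluster_succ (mem_cluster_self haω) hab hb)
    exact ⟨hbe, cluster_succ ha.2 hab (by rw [← hag b (hexU b hbe)]; exact hb)⟩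

theorem determinedBy_hidden (D U : Finset (Site d)) :
    DeterminedBy {ω | hidden D ω = U} (D \ U) := by
  intro ω ω' h hU
  have hU : hidden D ω = U := hU
  show hidden D ω' = U
  rw [← hU]
  unfold hidden
  rw [exiting_eq_of_agree h hU]

/-- The event that the occupation of `z` decides whether the cluster of `0` in `D` leaves `D`. -/
def pivotal (D : Finset (Site d)) (z : Site d) : Set (Config d) :=
  {ω | Function.update (restrictTo D ω) z true ∈ exitsFrom D 0 ∧
    Function.update (restrictTo D ω) z false ∉ exitsFrom D 0}

theorem determinedBy_pivotal (D : Finset (Site d)) (z : Site d) :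
    DeterminedBy (pivotal D z) (D.erase z) := by
  intro ω ω' h hω
  have : ∀ b, Function.update (restrictTo (D : Set (Site d)) ω) z b
      = Function.update (restrictTo D ω') z b := by
    intro b
    ext y
    by_cases hy : y = z
    · simp [hy]
    · by_cases hD : y ∈ D
      · simp [hy, hD, restrictTo, h y (by simp [hy, hD])]
      · simp [hy, hD, restrictTo]
  simpa [pivotal, this] using hω

theorem pivotal_of_vacant {D : Finset (Site d)} {ω : Config d} {z : Site d}
    (hz : restrictTo (D : Set (Site d)) ω z ≠ true) (hzD : z ∈ D)
    (h1 : Function.update (restrictTo D ω) z true ∈ exitsFrom D 0)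
    (h0 : restrictTo D ω ∉ exitsFrom D 0) : ω ∈ pivotal D z \ {ω | ω z = true} := by
  refine ⟨⟨h1, ?_⟩, ?_⟩
  · rwa [update_false_eq (by simpa using hz)]
  · rwa [restrictTo_of_mem (Finset.mem_coe.2 hzD)] at hz

/-- A non-exiting, non-hidden origin has a neighbour that is exiting or outside `D`; it must be
vacant, and occupying it would create an exit. -/
theorem pivotal_zero {D : Finset (Site d)} {ω : Config d} (hD : 0 ∈ D)
    (h0 : restrictTo D ω ∉ exitsFrom D 0) (hU : 0 ∉ hidden D ω) :
    ω ∈ pivotal D 0 \ {ω | ω 0 = true} := by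
  have : ∃ w, Nbr 0 w ∧ (w ∈ exiting D ω ∨ w ∉ D) := by
    by_contra! hcon
    exact hU ⟨hD, h0, fun w hw => by have := hcon w hw; tauto⟩
  obtain ⟨w, hw, hw'⟩ := this
  refine pivotal_of_vacant (fun h => h0 (mem_exitsFrom_of_nbr le_rfl h hw hw')) hD ?_ h0
  exact mem_exitsFrom_of_nbr (le_update_true _ _) (by simp) hw hw'

/-- A site bordering the hidden set is in `D` and not exiting, but it touches an exiting site or the
complement of `D`. It is thus vacant, and occupying it links the cluster of `0` in `U` to the
outside. -/
theorem pivotal_of_mem_bdry_hidden {D U : Finset (Site d)} {ω : Config d} {z : Site d}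
    (hU : hidden D ω = U) (hz : z ∈ bdry U) (hr : restrictTo U ω ∈ reachNbr 0 z) :
    z ∈ D ∧ ω ∈ pivotal D z \ {ω | ω z = true} := by
  have hU' : ∀ v, v ∈ U ↔ v ∈ hidden D ω := fun v => by rw [hU]; rfl
  obtain ⟨hzU, u, hu, huz⟩ := mem_bdry.1 hz
  have h1 := ((hU' u).1 hu).2.2 z huz
  have : ∃ w, Nbr z w ∧ (w ∈ exiting D ω ∨ w ∉ D) := by
    by_contra! hcon
    exact hzU ((hU' z).2 ⟨h1.2, h1.1, fun w hw => by have := hcon w hw; tauto⟩)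
  obtain ⟨w, hw, hw'⟩ := this
  obtain ⟨v, hv, hvz⟩ := hr
  have hUD : (U : Set (Site d)) ⊆ D := by rw [← hU]; exact fun v hv => hv.1
  have h0U : 0 ∈ U := cluster_restrictTo_subset _ _ _ (mem_cluster_self hv.1)
  refine ⟨h1.2, pivotal_of_vacant (fun h => h1.1 (mem_exitsFrom_of_nbr le_rfl h hw hw')) h1.2 ?_
    ((hU' 0).1 h0U).2.1⟩
  have hv' := cluster_mono ((restrictTo_mono hUD ω).trans (le_update_true _ z)) hv
  exact mem_exitsFrom_of_mem_cluster (cluster_succ hv' hvz (by simp))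
    (mem_exitsFrom_of_nbr (le_update_true _ _) (by simp) hw hw')

theorem measureReal_inter_hidden_le (p : unitInterval) {D U : Finset (Site d)} (hD : 0 ∈ D)
    (hφ : ∀ S : Finset (Site d), 0 ∈ S → 1 ≤ boundaryMean p S) :
    (bernoulliSite d p).real ({ω | restrictTo D ω ∈ exitsFrom D 0}ᶜ ∩ {ω | hidden D ω = U})
      ≤ ∑ z ∈ D, (bernoulliSite d p).real
          ((pivotal D z \ {ω | ω z = true}) ∩ {ω | hidden D ω = U}) := by
  set μ := bernoulliSite d p
  by_cases hne : ∃ ω, hidden D ω = U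
  swap
  · push Not at hne
    have : {ω | hidden D ω = U} = ∅ := Set.eq_empty_of_forall_notMem hne
    simp [this]
  obtain ⟨ω₀, hω₀⟩ := hne
  -- If `0` is hidden, `{hidden D ω = U}` is independent of the states inside `U`, and `φ(U) ≥ 1`
  -- supplies on average at least one pivotal site on the boundary of `U`. Otherwise `0` itself is
  -- pivotal.
  by_cases h0 : 0 ∈ U
  · have hbD : bdry U ⊆ D := by
      intro z hz
      obtain ⟨_, u, hu, huz⟩ := mem_bdry.1 hz
      rw [← Finset.mem_coe, ← hω₀] at hu
      exact (hu.2.2 z huz).2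
    calc _ ≤ μ.real {ω | hidden D ω = U} := measureReal_mono Set.inter_subset_right
      _ ≤ μ.real {ω | hidden D ω = U} * boundaryMean p U :=
          le_mul_of_one_le_right measureReal_nonneg (hφ U h0)
      _ = ∑ z ∈ bdry U, μ.real ({ω | hidden D ω = U} ∩ {ω | restrictTo U ω ∈ reachNbr 0 z}) := by
          rw [boundaryMean, Finset.mul_sum]
          refine Finset.sum_congr rfl fun z _ => ?_
          exact (bernoulliSite_inter_restrictTo p U Finset.sdiff_disjoint _
            (determinedBy_hidden D U)).symm
      _ ≤ ∑ z ∈ bdry U, μ.real ((pivotal D z \ {ω | ω z = true}) ∩ {ω | hidden D ω = U}) :=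
          Finset.sum_le_sum fun z hz => measureReal_mono fun ω hω =>
            ⟨(pivotal_of_mem_bdry_hidden hω.1 hz hω.2).2, hω.1⟩
      _ ≤ _ := Finset.sum_le_sum_of_subset_of_nonneg hbD fun _ _ _ => measureReal_nonneg
  · refine le_trans ?_ (Finset.single_le_sum (f := fun z => μ.real
      ((pivotal D z \ {ω | ω z = true}) ∩ {ω | hidden D ω = U}))
      (fun _ _ => measureReal_nonneg) hD)
    refine measureReal_mono ?_
    rintro ω ⟨h1, h2⟩
    refine ⟨pivotal_zero hD h1 ?_, h2⟩
    have h2 : hidden D ω = U := h2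
    rw [h2]; exact h0

/-- Sum over all values of the hidden set. The factor `1 - p` is the probability that a site is
vacant, independently of its being pivotal. -/
theorem deriv_weight_exitsFrom_ge (p : unitInterval) {D : Finset (Site d)} (hD : 0 ∈ D)
    (hφ : ∀ S : Finset (Site d), 0 ∈ S → 1 ≤ boundaryMean p S) :
    1 - weight p D (exitsFrom D 0) ≤
      (1 - p) * ∑ z ∈ D, (weight p D {ω | Function.update ω z true ∈ exitsFrom D 0}
        - weight p D {ω | Function.update ω z false ∈ exitsFrom D 0}) := by
  set μ := bernoulliSite d p
  have hdiff : ∀ z, weight p D {ω | Function.update ω z true ∈ exitsFrom D 0}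
        - weight p D {ω | Function.update ω z false ∈ exitsFrom D 0} = μ.real (pivotal D z) := by
    intro z
    rw [← bernoulliSite_restrictTo, ← bernoulliSite_restrictTo, ← measureReal_sdiff]
    · rfl
    · intro ω hω
      have hω : Function.update (restrictTo (D : Set (Site d)) ω) z false ∈ exitsFrom D 0 := hω
      refine isUpperSet_exitsFrom D 0 ?_ hω
      exact update_le_update_iff.2 ⟨Bool.false_le _, fun _ _ => le_rfl⟩
    · exact (determinedBy_restrictTo D _).measurableSet
  have hmF : MeasurableSet {ω : Config d | restrictTo (D : Set (Site d)) ω ∈ exitsFrom D 0} :=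
    (determinedBy_restrictTo D _).measurableSet
  have hcov : ({ω : Config d | restrictTo (D : Set (Site d)) ω ∈ exitsFrom D 0}ᶜ) ⊆
      ⋃ U ∈ D.powerset, {ω | restrictTo (D : Set (Site d)) ω ∈ exitsFrom D 0}ᶜ ∩
        {ω | hidden D ω = U} := by
    intro ω hω
    have hfin : (hidden D ω).Finite := D.finite_toSet.subset fun v hv => hv.1
    refine Set.mem_biUnion (x := hfin.toFinset) ?_ ⟨hω, ?_⟩
    · rw [Finset.mem_coe, Finset.mem_powerset, Set.Finite.toFinset_subset]
      exact fun v hv => hv.1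
    · simp
  calc 1 - weight p D (exitsFrom D 0)
      = μ.real {ω | restrictTo (D : Set (Site d)) ω ∈ exitsFrom D 0}ᶜ := by
        rw [← bernoulliSite_restrictTo, probReal_compl_eq_one_sub hmF]
    _ ≤ ∑ U ∈ D.powerset, μ.real ({ω | restrictTo (D : Set (Site d)) ω ∈ exitsFrom D 0}ᶜ ∩
          {ω | hidden D ω = U}) :=
        (measureReal_mono hcov (measure_ne_top _ _)).trans (measureReal_biUnion_finset_le _ _)
    _ ≤ ∑ U ∈ D.powerset, ∑ z ∈ D, μ.real
          ((pivotal D z \ {ω | ω z = true}) ∩ {ω | hidden D ω = U}) :=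
        Finset.sum_le_sum fun U _ => measureReal_inter_hidden_le p hD hφ
    _ = ∑ z ∈ D, ∑ U ∈ D.powerset, μ.real
          ((pivotal D z \ {ω | ω z = true}) ∩ {ω | hidden D ω = U}) := Finset.sum_comm
    _ ≤ ∑ z ∈ D, μ.real (pivotal D z \ {ω | ω z = true}) := by
        refine Finset.sum_le_sum fun z _ => ?_
        rw [← measureReal_biUnion_finset]
        · exact measureReal_mono (Set.iUnion₂_subset fun _ _ => Set.inter_subset_left)
        · intro U _ U' _ hne
          refine Set.disjoint_left.2 fun ω h h' => hne ?_
          exact Finset.coe_injective (h.2.symm.trans h'.2)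
        · intro U _
          exact ((determinedBy_pivotal D z).measurableSet.diff
            (determinedBy_occupied z).measurableSet).inter (determinedBy_hidden D U).measurableSet
    _ = _ := by
        rw [Finset.mul_sum]
        refine Finset.sum_congr rfl fun z _ => ?_
        rw [hdiff, bernoulliSite_sdiff_occupied p (Finset.notMem_erase z D)
          (determinedBy_pivotal D z)]

theorem le_weight_exitsFrom {p q : ℝ} (h0 : 0 ≤ p) (hpq : p < q) (h1 : q ≤ 1)
    {D : Finset (Site d)} (hD : 0 ∈ D)
    (hφ : ∀ S : Finset (Site d), 0 ∈ S → 1 ≤ boundaryMean p S) :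
    (q - p) / 2 ≤ weight q D (exitsFrom D 0) := by
  -- The mean value theorem replaces integration. With `θ` increasing, it leads to `(1 - θ(q)) (q -
  -- p) ≤ θ(q)`; the constant `1/2` then comes from `1 + (q - p) ≤ 2`.
  obtain ⟨c, hc, hc'⟩ := exists_hasDerivAt_eq_slope (fun s => weight s D (exitsFrom D 0)) _ hpq
    (fun s _ => (weight_hasDerivAt s D _).continuousAt.continuousWithinAt)
    (fun s _ => weight_hasDerivAt s D _)
  have hcI : c ∈ Set.Icc (0 : ℝ) 1 := ⟨h0.trans hc.1.le, hc.2.le.trans h1⟩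
  have key := deriv_weight_exitsFrom_ge ⟨c, hcI⟩ hD
    fun S hS => (hφ S hS).trans (boundaryMean_mono h0 hc.1.le hcI.2 S)
  simp only at key
  rw [hc', mul_div_assoc', le_div_iff₀ (by linarith)] at key
  have m1 := weight_mono_param h0 hpq.le h1 D (isUpperSet_exitsFrom D 0)
  have m2 := weight_mono_param hcI.1 hc.2.le h1 D (isUpperSet_exitsFrom D 0)
  have m3 := weight_nonneg h0 (hpq.le.trans h1) D (exitsFrom D 0)
  have m4 := weight_nonneg (h0.trans hpq.le) h1 D (exitsFrom D 0)
  set a := weight q D (exitsFrom D 0)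
  have e1 : (1 - a) * (q - p) ≤ (1 - weight c D (exitsFrom D 0)) * (q - p) :=
    mul_le_mul_of_nonneg_right (by linarith) (by linarith)
  have e2 : (1 - c) * (a - weight p D (exitsFrom D 0)) ≤ 1 * (a - weight p D (exitsFrom D 0)) :=
    mul_le_mul_of_nonneg_right (by linarith [hcI.1]) (by linarith)
  nlinarith

/-! ### Subcriticality in finite volume -/

/-- The sites of maximum norm at most `n`. -/
def box (d n : ℕ) : Finset (Site d) := Finset.Icc (fun _ => -(n : ℤ)) (fun _ => (n : ℤ))

theorem mem_box {n : ℕ} {y : Site d} : y ∈ box d n ↔ ‖y‖ ≤ n := by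
  rw [pi_norm_le_iff_of_nonneg (Nat.cast_nonneg n), box, Finset.mem_Icc, Pi.le_def, Pi.le_def,
    ← forall_and]
  refine forall_congr' fun i => ?_
  rw [Int.norm_eq_abs, ← abs_le]
  exact_mod_cast Iff.rfl

theorem card_box (d n : ℕ) : (box d n).card = (2 * n + 1) ^ d := by
  rw [box, Pi.card_Icc]
  simp only [Int.card_Icc, Finset.prod_const, Finset.card_univ, Fintype.card_fin]
  congr 1
  omega

theorem exists_infinite_of_frequently {ω : Config d}
    (h : ∀ n : ℕ, ∃ k ≥ n, restrictTo (box d k) ω ∈ exitsFrom (box d k) 0) :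
    (cluster 0 ω).Infinite := by
  intro hfin
  obtain ⟨M, hM⟩ := hfin.isBounded.exists_norm_le
  obtain ⟨k, hk, v, hv, z, hz, hvz⟩ := h (⌈M⌉₊ + 1)
  have h1 := hM v (cluster_mono (restrictTo_le _ _) hv)
  rw [mem_box, not_le] at hz
  have h2 : ‖z‖ ≤ ‖z - v‖ + ‖v‖ := by simpa using norm_add_le (z - v) v
  have h3 := hvz.symm.norm_sub_le
  have h4 : M ≤ ⌈M⌉₊ := Nat.le_ceil M
  have h5 : ((⌈M⌉₊ + 1 : ℕ) : ℝ) ≤ k := by exact_mod_cast hk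
  push_cast at h5
  linarith

theorem exists_boundaryMean_lt_one {p : ℝ} (h0 : 0 ≤ p) (hp : p < criticalValue d) :
    ∃ S : Finset (Site d), 0 ∈ S ∧ boundaryMean p S < 1 := by
  by_contra! hφ
  have hne : {q : ℝ | ∃ p : unitInterval, (p : ℝ) = q ∧
    ∀ᵐ ω ∂(bernoulliSite d p), ¬ ∃ x : Site d, (cluster x ω).Infinite}.Nonempty := by
    -- The supremum of the empty set is `0` by convention, which contradicts `0 ≤ p < p_c`.
    by_contra h
    rw [Set.not_nonempty_iff_eq_empty] at h
    rw [criticalValue, h, Real.sSup_empty] at hp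
    linarith
  obtain ⟨_, ⟨q, rfl, hq⟩, hpq⟩ := exists_lt_of_lt_csSup hne hp
  set μ := bernoulliSite d q
  set A : ℕ → Set (Config d) := fun k => {ω | restrictTo (box d k) ω ∈ exitsFrom (box d k) 0}
  have hAm : ∀ k, MeasurableSet (A k) := fun k => (determinedBy_restrictTo _ _).measurableSet
  -- Tail unions decrease by construction, so continuity from above applies without proving that the
  -- exit events are nested.
  set G : ℕ → Set (Config d) := fun n => ⋃ k ≥ n, A k
  have hGm : ∀ n, MeasurableSet (G n) := fun n =>
    MeasurableSet.iUnion fun k => MeasurableSet.iUnion fun _ => hAm k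
  have hG : Antitone G := fun m n hmn =>
    Set.biUnion_subset_biUnion_left fun k (hk : n ≤ k) => hmn.trans hk
  have hlim := tendsto_measure_iInter_atTop (μ := μ) (fun n => (hGm n).nullMeasurableSet) hG
    ⟨0, measure_ne_top _ _⟩
  have hzero : μ (⋂ n, G n) = 0 := by
    refine measure_mono_null ?_ (ae_iff.1 hq)
    intro ω hω
    simp only [not_not, Set.mem_ofPred_eq]
    refine ⟨0, exists_infinite_of_frequently fun n => ?_⟩
    have := Set.mem_iInter.1 hω n
    simpa [G, A] using this
  rw [hzero] at hlim
  have hge : ∀ n, ENNReal.ofReal ((q - p) / 2) ≤ μ (G n) := by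
    intro n
    refine le_trans ?_ (measure_mono (Set.subset_biUnion_of_mem (u := A) (le_refl n)))
    rw [← ofReal_measureReal (measure_ne_top _ _)]
    refine ENNReal.ofReal_le_ofReal ?_
    rw [bernoulliSite_restrictTo]
    exact le_weight_exitsFrom h0 hpq q.2.2 (mem_box.2 (by simp)) hφ
  have := ge_of_tendsto' hlim hge
  simp at this
  linarith

/-! ### Large clusters -/

theorem determinedBy_cluster_zero_eq {A : Finset (Site d)} (hA : 0 ∈ A) :
    DeterminedBy {ω | cluster 0 ω = A} (A ∪ bdry A) := by
  intro ω ω' h hω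
  refine cluster_eq_of_agree hA (fun y hy => h y (Finset.mem_union_left _ hy))
    (fun y hy z hyz => h z ?_) hω
  by_cases hz : z ∈ A
  · exact Finset.mem_union_left _ hz
  · exact Finset.mem_union_right _ (mem_bdry.2 ⟨hz, y, hy, hyz⟩)

/-- For `n = 0` the empty value of `leftCluster` would also qualify; `1 ≤ n` excludes it. -/
theorem mem_largeLeftCluster {n : ℕ} (hn : 1 ≤ n) {x : Site d} {ω : Config d} :
    ω ∈ largeLeftCluster n x ↔ (∀ y ∈ cluster x ω, toLex x ≤ toLex y) ∧
      (n : ℕ∞) ≤ (cluster x ω).encard ∧ (cluster x ω).Finite := by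
  unfold largeLeftCluster leftCluster
  by_cases h : ∀ y ∈ cluster x ω, toLex x ≤ toLex y
  · simp only [Set.mem_ofPred_eq, if_pos h, Set.encard_lt_top_iff]
    tauto
  · simp only [Set.mem_ofPred_eq, if_neg h]
    have : n ≠ 0 := by omega
    simp [this, h]

/-- The possible values of a finite `C_le(0)` of size at least `n`. -/
def leftAnimals (d n : ℕ) : Set (Finset (Site d)) :=
  {A | 0 ∈ A ∧ n ≤ A.card ∧ ∀ y ∈ A, toLex 0 ≤ toLex y}

theorem largeLeftCluster_zero_eq {n : ℕ} (hn : 1 ≤ n) :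
    largeLeftCluster n (0 : Site d)
      = ⋃ A : leftAnimals d n, {ω | cluster 0 ω = (A : Finset (Site d))} := by
  ext ω
  rw [mem_largeLeftCluster hn, Set.mem_iUnion]
  constructor
  · rintro ⟨h1, h2, h3⟩
    have hne : (cluster 0 ω).Nonempty := by
      rw [← Set.one_le_encard_iff_nonempty]
      exact le_trans (by exact_mod_cast hn) h2
    obtain ⟨y, hy⟩ := hne
    refine ⟨⟨h3.toFinset, ?_, ?_, ?_⟩, ?_⟩
    · simpa using mem_cluster_self hy.1
    · rw [h3.encard_eq_coe_toFinset_card] at h2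
      exact_mod_cast h2
    · simpa using h1
    · simp
  · rintro ⟨⟨A, hA0, hAn, hA⟩, hω⟩
    have hω : cluster 0 ω = A := hω
    rw [hω]
    refine ⟨hA, ?_, A.finite_toSet⟩
    rw [Set.encard_coe_eq_coe_finsetCard]
    exact_mod_cast hAn

/-- A large finite cluster with minimum `x`, distinct from the cluster `A` of `0`, extends far from
`x` without using the sites of `A` and of its boundary. -/
theorem mem_reachDist_of_largeLeftCluster {n N : ℕ} (hn : (2 * N + 1) ^ d < n) {x : Site d}
    (hx : x ≠ 0) {A : Finset (Site d)} (hA : ∀ y ∈ A, toLex 0 ≤ toLex y) {ω : Config d}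
    (hω : cluster 0 ω = A) (hωx : ω ∈ largeLeftCluster n x) :
    ω ∈ reachDist N (A ∪ bdry A) x := by
  obtain ⟨h1, h2, -⟩ := (mem_largeLeftCluster (by omega)).1 hωx
  -- Otherwise `x` and `0` would both be the lexicographic minimum of the same cluster.
  have hxA : x ∉ A := by
    intro h
    have h3 : x ∈ cluster 0 ω := by rw [hω]; exact h
    have h4 := h1 0 (mem_cluster_symm h3)
    exact hx (toLex.injective (le_antisymm h4 (hA x h)))
  have hdisj : ∀ y ∈ cluster x ω, y ∉ A ∪ bdry A := by
    intro y hy hyA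
    have hy' : y ∈ cluster 0 ω := by
      rcases Finset.mem_union.1 hyA with h | h
      · rw [hω]; exact h
      · obtain ⟨_, v, hv, hvy⟩ := mem_bdry.1 h
        rw [← Finset.mem_coe, ← hω] at hv
        exact cluster_succ hv hvy (occupied_of_mem_cluster hy)
    refine hxA ?_
    rw [← Finset.mem_coe, ← hω]
    exact mem_cluster_trans hy' (mem_cluster_symm hy)
  have hocc : ∀ y ∈ cluster x ω,
      restrictTo ((A ∪ bdry A : Finset (Site d)) : Set (Site d))ᶜ ω y = true := fun y hy =>
    restrictTo_eq_true.2 ⟨by simpa using hdisj y hy, occupied_of_mem_cluster hy⟩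
  have hsub : cluster x ω ⊆
      cluster x (restrictTo ((A ∪ bdry A : Finset (Site d)) : Set (Site d))ᶜ ω) := by
    intro y hy
    have hxx := mem_cluster_self hy.1
    refine (cluster_subset (A := {y | y ∈ cluster x ω ∧
      y ∈ cluster x (restrictTo ((A ∪ bdry A : Finset (Site d)) : Set (Site d))ᶜ ω)})
      (fun _ => ⟨hxx, mem_cluster_self (hocc x hxx)⟩) (fun a ha b _ hab hb => ?_) hy).2
    have hb' := cluster_succ ha.1 hab hb
    exact ⟨hb', cluster_succ ha.2 hab (hocc b hb')⟩
  by_contra hcon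
  -- A cluster not reaching distance `N` fits in a box of `(2 * N + 1) ^ d < n` sites.
  have hsub' : cluster x ω ⊆ ((box d N).image (x + ·) : Finset (Site d)) := by
    intro y hy
    have h3 : ¬ (N : ℝ) ≤ ‖y - x‖ := fun h => hcon ⟨y, hsub hy, h⟩
    refine Finset.mem_coe.2 (Finset.mem_image.2 ⟨y - x, mem_box.2 (not_le.1 h3).le, by simp⟩)
  have h4 := h2.trans (Set.encard_le_encard hsub')
  rw [Set.encard_coe_eq_coe_finsetCard] at h4
  have h5 : n ≤ ((box d N).image (x + ·)).card := by exact_mod_cast h4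
  have h6 := h5.trans Finset.card_image_le
  rw [card_box] at h6
  omega

/-- Condition on the cluster `A` of `0`: the decay bound off `A` and its boundary is uniform in `A`,
so summing over the countably many `A` restores the probability of the event at `0`. -/
theorem Subordinate.largeLeftCluster_inter_le {P : Measure (Config d)} [IsFiniteMeasure P] {p : ℝ}
    (h0 : 0 ≤ p) (h1 : p ≤ 1) (hν : Subordinate P p) {S : Finset (Site d)} (hS : 0 ∈ S)
    {L : ℕ} (hL : ∀ s ∈ S, ‖s‖ + 1 ≤ L) {n k : ℕ} (hn : (2 * (k * L) + 1) ^ d < n)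
    {x : Site d} (hx : x ≠ 0) :
    P (largeLeftCluster n x ∩ largeLeftCluster n 0)
      ≤ ENNReal.ofReal (boundaryMean p S ^ k) * P (largeLeftCluster n 0) := by
  have hm : ∀ A : leftAnimals d n, DeterminedBy {ω | cluster 0 ω = (A : Finset (Site d))}
      ((A : Finset (Site d)) ∪ bdry (A : Finset (Site d))) := by
    rintro ⟨A, hA0, -⟩
    exact determinedBy_cluster_zero_eq hA0
  rw [largeLeftCluster_zero_eq (by omega), Set.inter_iUnion]
  refine (measure_iUnion_le _).trans ?_
  have hdisj : Pairwise (Function.onFun Disjoint fun A : leftAnimals d n =>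
      {ω : Config d | cluster 0 ω = (A : Finset (Site d))}) := by
    intro A A' hne
    refine Set.disjoint_left.2 fun ω h h' => hne (Subtype.ext (Finset.coe_injective ?_))
    have h : cluster 0 ω = (A : Finset (Site d)) := h
    have h' : cluster 0 ω = (A' : Finset (Site d)) := h'
    exact h.symm.trans h'
  rw [measure_iUnion hdisj fun A => (hm A).measurableSet, ← ENNReal.tsum_mul_left]
  refine ENNReal.tsum_le_tsum fun A => ?_
  have hsub : largeLeftCluster n x ∩ {ω | cluster 0 ω = (A : Finset (Site d))} ⊆
      {ω | cluster 0 ω = (A : Finset (Site d))} ∩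
        reachDist (k * L) ((A : Finset (Site d)) ∪ bdry (A : Finset (Site d))) x := by
    obtain ⟨A, -, -, hA⟩ := A
    rintro ω ⟨hωx, hω⟩
    refine ⟨hω, ?_⟩
    have := mem_reachDist_of_largeLeftCluster hn hx hA hω hωx
    simpa using this
  refine (measure_mono hsub).trans ?_
  have key := hν.reachDist_le h0 h1 hS hL k _ _ (hm A) x
  rw [← ofReal_measureReal (measure_ne_top _ _),
    ← ofReal_measureReal (measure_ne_top P {ω | cluster 0 ω = (A : Finset (Site d))}),
    ← ENNReal.ofReal_mul (pow_nonneg (boundaryMean_nonneg h0 h1 S) k)]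
  exact ENNReal.ofReal_le_ofReal key

/-! ### The second-moment condition -/

theorem exists_radius {d : ℕ} (hd : d ≠ 0) {L : ℕ} (hL : 1 ≤ L) {n : ℕ} (hn : 2 ≤ n) :
    ∃ k : ℕ, (2 * (k * L) + 1) ^ d < n ∧ n ≤ (3 * L * (k + 1)) ^ d := by
  have hex : ∃ k : ℕ, n ≤ (2 * ((k + 1) * L) + 1) ^ d := by
    refine ⟨n, ?_⟩
    calc n ≤ 2 * ((n + 1) * L) + 1 := by nlinarith
      _ ≤ _ := Nat.le_self_pow hd _
  classical
  -- The least `k` whose successor gives a box of at least `n` sites; minimality makes the box for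
  -- `k` itself too small, and `2 ≤ n` handles `k = 0`.
  refine ⟨Nat.find hex, ?_, (Nat.find_spec hex).trans (Nat.pow_le_pow_left ?_ d)⟩
  · rcases h : Nat.find hex with _ | k
    · simpa using by omega
    · have := Nat.find_min hex (m := k) (by omega)
      omega
  · nlinarith

theorem exists_bound_pow_mul_pow {r : ℝ} (h0 : 0 < r) (h1 : r < 1) (M : ℕ) :
    ∃ C : ℝ, ∀ k : ℕ, ((k : ℝ) + 1) ^ M * r ^ k ≤ C := by
  have h := tendsto_pow_const_mul_const_pow_of_abs_lt_one M (abs_lt.2 ⟨by linarith, h1⟩)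
  obtain ⟨C, hC⟩ := h.bddAbove_range
  -- The bounded sequence is taken at index `k + 1`, and the extra factor `r` is divided out.
  refine ⟨C / r, fun k => ?_⟩
  rw [le_div_iff₀ h0]
  have := hC ⟨k + 1, rfl⟩
  simp only [Nat.cast_add, Nat.cast_one, pow_succ r] at this
  linarith

theorem card_norm_lt_rpow_le {n : ℕ} (hn : 1 ≤ n) {α : ℝ} :
    ENat.card {x : Site d // 0 < ‖x‖ ∧ ‖x‖ < (n : ℝ) ^ α} ≤ ((3 * n ^ ⌈α⌉₊) ^ d : ℕ) := by
  have hsub : {x : Site d | 0 < ‖x‖ ∧ ‖x‖ < (n : ℝ) ^ α} ⊆ (box d (n ^ ⌈α⌉₊) : Finset (Site d)) := by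
    rintro x ⟨_, hx⟩
    refine Finset.mem_coe.2 (mem_box.2 (hx.le.trans ?_))
    push_cast
    rw [← Real.rpow_natCast]
    exact Real.rpow_le_rpow_of_exponent_le (by exact_mod_cast hn) (Nat.le_ceil α)
  have := Set.encard_le_encard hsub
  rw [Set.encard_coe_eq_coe_finsetCard, card_box] at this
  refine le_trans this ?_
  norm_cast
  refine Nat.pow_le_pow_left ?_ d
  have := Nat.one_le_pow ⌈α⌉₊ n hn
  omega

theorem criticalValue_le_one (d : ℕ) : criticalValue d ≤ 1 := by
  refine Real.sSup_le ?_ zero_le_one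
  rintro _ ⟨p, rfl, _⟩
  exact p.2.2

theorem Subordinate.secondMomentCondition {P : Measure (Config d)} [IsProbabilityMeasure P] {p : ℝ}
    (h0 : 0 ≤ p) (hν : Subordinate P p) (hp : p < criticalValue d) : SecondMomentCondition P := by
  intro α _
  have h1 : p ≤ 1 := hp.le.trans (criticalValue_le_one d)
  rcases eq_or_ne d 0 with rfl | hd
  · have : ∀ n : ℕ, IsEmpty {x : Site 0 // 0 < ‖x‖ ∧ ‖x‖ < (n : ℝ) ^ α} := fun n =>
      ⟨fun x => by
        have h := x.2.1
        rw [Subsingleton.elim x.1 0, norm_zero] at h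
        exact lt_irrefl _ h⟩
    simp
  obtain ⟨S, hS, hφ⟩ := exists_boundaryMean_lt_one h0 hp
  have hφ0 := boundaryMean_nonneg h0 h1 S
  obtain ⟨L, hL⟩ : ∃ L : ℕ, ∀ s ∈ S, ‖s‖ + 1 ≤ L := by
    obtain ⟨M, hM⟩ := S.finite_toSet.isBounded.exists_norm_le
    exact ⟨⌈M⌉₊ + 1, fun s hs => by
      have := Nat.le_ceil M
      have := hM s hs
      push_cast; linarith⟩
  have hL1 : 1 ≤ L := by
    have := hL 0 hS
    rw [norm_zero, zero_add] at this
    exact_mod_cast this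
  -- The midpoint between `φ` and `1` is strictly positive even if `φ = 0`, as
  -- `exists_bound_pow_mul_pow` requires.
  set r : ℝ := (boundaryMean p S + 1) / 2 with hr
  set m := ⌈α⌉₊
  -- There are at most `3 ^ d * n ^ (m * d)` sites `x`, and `n ≤ (3 * L * (k + 1)) ^ d`; hence this
  -- power of `k + 1`.
  obtain ⟨C, hC⟩ := exists_bound_pow_mul_pow (r := r) (by linarith) (by linarith) (d * m * d)
  refine lt_of_le_of_lt (limsup_le_of_le (a := ENNReal.ofReal (3 ^ d * (3 * L) ^ (d * m * d) * C))
    (by isBoundedDefault) ?_) ENNReal.ofReal_lt_top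
  filter_upwards [eventually_ge_atTop 2] with n hn
  obtain ⟨k, hk, hk'⟩ := exists_radius hd hL1 hn
  have hterm : ∀ x : {x : Site d // 0 < ‖x‖ ∧ ‖x‖ < (n : ℝ) ^ α},
      P (largeLeftCluster n x.1 ∩ largeLeftCluster n 0) / P (largeLeftCluster n (0 : Site d))
        ≤ ENNReal.ofReal (r ^ k) := by
    intro x
    refine ENNReal.div_le_of_le_mul ?_
    refine (hν.largeLeftCluster_inter_le h0 h1 hS hL hk (norm_pos_iff.1 x.2.1)).trans ?_
    gcongr
    linarith
  refine (ENNReal.tsum_le_tsum hterm).trans ?_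
  rw [ENNReal.tsum_const]
  have hr0 : 0 ≤ r := by linarith
  calc _ ≤ ((((3 * n ^ m) ^ d : ℕ) : ℕ∞) : ℝ≥0∞) * ENNReal.ofReal (r ^ k) := by
        gcongr
        exact card_norm_lt_rpow_le (by omega)
    _ = ENNReal.ofReal (((3 * n ^ m) ^ d : ℕ) * r ^ k) := by
        rw [ENNReal.ofReal_mul (Nat.cast_nonneg _), ENNReal.ofReal_natCast]
        rfl
    _ ≤ _ := by
        refine ENNReal.ofReal_le_ofReal ?_
        have hn' : ((3 * n ^ m) ^ d : ℕ) ≤ 3 ^ d * (3 * L * (k + 1)) ^ (d * m * d) := by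
          rw [mul_pow, ← pow_mul]
          refine Nat.mul_le_mul_left _ ?_
          calc n ^ (m * d) ≤ ((3 * L * (k + 1)) ^ d) ^ (m * d) := Nat.pow_le_pow_left hk' _
            _ = _ := by rw [← pow_mul, ← mul_assoc d]
        calc (((3 * n ^ m) ^ d : ℕ) : ℝ) * r ^ k
            ≤ ((3 ^ d * (3 * L * (k + 1)) ^ (d * m * d) : ℕ) : ℝ) * r ^ k := by
              gcongr
          _ = 3 ^ d * (3 * L) ^ (d * m * d) * (((k : ℝ) + 1) ^ (d * m * d) * r ^ k) := by
              push_cast; rw [mul_pow (3 * (L : ℝ))]; ring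
          _ ≤ _ := by
              gcongr
              exact hC k

end SitePercolation

end

theorem mainTheorem9 (d : ℕ) (P : MeasureTheory.Measure (SitePercolation.Config d))
    [MeasureTheory.IsProbabilityMeasure P]
    (hP : SitePercolation.TranslationInvariant P)
    (p : ℝ) (hp : p < SitePercolation.criticalValue d)
    (hdom : SitePercolation.HolleyDominated P p) :
    SitePercolation.SecondMomentCondition P := by
  have hν := SitePercolation.subordinate_of_holleyDominated hP hdom
  -- The trivial conditioning event gives `0 ≤ P(ω(0) = 1) ≤ p`.
  have h0 : 0 ≤ p := by
    have := hν 0 ∅ Set.univ (Finset.notMem_empty _) (SitePercolation.determinedBy_univ ∅)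
    rw [MeasureTheory.probReal_univ, mul_one] at this
    exact MeasureTheory.measureReal_nonneg.trans this
  exact hν.secondMomentCondition h0 hp
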